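/- Let $N\in\mathbb N=\{1,2,\dots\}$ and $\sigma^2>0$; write $\mathbb W_N^{\rm A}=\{x\in\mathbb R^N: x_1<\dots<x_N\}$, $\mathbb W_N^+=\{x\in\mathbb R^N:0\le x_1<\dots<x_N\}$, $h_N(x)=\prod_{j<k}(x_k-x_j)$. **Kernels.** For $t\in\mathbb R\setminus\{0\}$ and $x,y\in\mathbb C$ let $p(t,y|x)=\frac1{\sqrt{2\pi|t|}}e^{-(x-y)^2/2t}$, and for $\nu>-1$ let $$p^{(\nu)}(t,y|x)=\tfrac{1}{2|t|}\big(\tfrac yx\big)^{\nu/2}e^{-(x+y)/2t}I_\nu\big(\tfrac{\sqrt{xy}}t\big)\ (x\ne0),\qquad p^{(\nu)}(t,y|0)=\frac{y^\nu e^{-y/2t}}{(2|t|)^{\nu+1}\Gamma(\nu+1)},$$ with principal powers (and $0^\alpha=0$ for $\alpha\neq0$, $0^0=1$) and $I_\nu(z)=\sum_{n\ge0}\frac{(z/2)^{2n+\nu}}{\Gamma(n+1)\Gamma(n+1+\nu)}$. Put $f(t,y|x)=\det[p(t,y_j|x_k)]_{j,k=1}^N$ and $f^{(\nu)}(t,y|x)=\det[p^{(\nu)}(t,y_j|x_k)]_{j,k=1}^N$.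 **Multitime densities.** For $\xi=\sum_{j=1}^N\delta_{a_j}$ with $a_1\le\dots\le a_N$ and $0\le n\le N-1$ let $$\phi^{(+)}_n(t,x;\xi)=\frac1{2\pi i}\oint p(t,x|s)\prod_{j=1}^{n+1}\frac{1}{s-a_j}\,ds,\qquad \phi^{(-)}_n(t,x;\xi)=\int_{\mathbb R}p(-t,is|x)\prod_{j=1}^n(is-a_j)\,ds,$$ and, if all $a_j\ge0$, $$\phi^{(\nu,+)}_n(t,x;\xi)=\frac1{2\pi i}\oint p^{(\nu)}(t,x|s)\prod_{j=1}^{n+1}\frac{1}{s-a_j}\,ds,\qquad \phi^{(\nu,-)}_n(t,x;\xi)=\int_{-\infty}^0p^{(\nu)}(-t,s|x)\prod_{j=1}^n(s-a_j)\,ds,$$ the contour being a positively oriented circle about $0$ that encircles all $a_j$. Let $h^{(\pm)}_N(t,y;\xi)=\det[\phi^{(\pm)}_{j-1}(t,y_k;\xi)]_{j,k=1}^N$ and $h^{(\nu,\pm)}_N(t,y;\xi)=\det[\phi^{(\nu,\pm)}_{j-1}(t,y_k;\xi)]_{j,k=1}^N$. For $M\in\mathbb N$, $0<t_1<\dots<t_M$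 and $\xi^{(m)}=\sum_j\delta_{x^{(m)}_j}$ with $x^{(m)}\in\mathbb W_N^{\rm A}$, the multitime density of the noncolliding Brownian motion started from $\xi$ is $$p^\xi(t_1,\xi^{(1)};\dots;t_M,\xi^{(M)})=h_N^{(-)}(t_M,x^{(M)};\xi)\prod_{m=1}^{M-1}f(t_{m+1}-t_m,x^{(m+1)}|x^{(m)})\;h_N^{(+)}(t_1,x^{(1)};\xi).$$ For $x^{(m)}\in\mathbb W_N^+$, the density $p^\xi_\nu$ of the noncolliding squared Bessel process of index $\nu$ is given by the same formula with $h_N^{(\nu,\pm)}$ and $f^{(\nu)}$. **Initial laws.** On $\mathbb W_N^{\rm A}$, respectively $\mathbb W_N^+$, let $$\mu_{N,\sigma^2}(x)=\frac{\sigma^{-N^2}e^{-|x|^2/2\sigma^2}h_N(x)^2}{(2\pi)^{N/2}\prod_{j=1}^N\Gamma(j)},\qquad \mu^{(\nu)}_{N,\sigma^2}(x)=\frac{\sigma^{-2N(N+\nu)}\prod_{j}x_j^\nu e^{-x_j/2\sigma^2}\,h_N(x)^2}{2^{N(N+\nu)}\prod_{j=1}^N\Gamma(j)\Gamma(j+\nu)},$$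 and let $\mathbf E_{N,\sigma^2}$, $\mathbf E^{(\nu)}_{N,\sigma^2}$ denote the expectations for $\Xi=\sum_j\delta_{x_j}$, where $x$ has the density $\mu_{N,\sigma^2}$, respectively $\mu^{(\nu)}_{N,\sigma^2}$. **Theorem.** (1) For all $M\in\mathbb N$, $0<t_1<\dots<t_M<\infty$ and $x^{(m)}\in\mathbb W_N^{\rm A}$ ($1\le m\le M$), the following expectation exists as an absolutely convergent integral and $$\mathbf E_{N,\sigma^2}\big[p^{\Xi}(t_1,\xi^{(1)};\dots;t_M,\xi^{(M)})\big]=p^{N\delta_0}(t_1+\sigma^2,\xi^{(1)};\dots;t_M+\sigma^2,\xi^{(M)}).$$ (2) For all $\nu>-1$, $M\in\mathbb N$, $0<t_1<\dots<t_M<\infty$ and $x^{(m)}\in\mathbb W_N^+$ ($1\le m\le M$), likewise $$\mathbf E^{(\nu)}_{N,\sigma^2}\big[p_\nu^{\Xi}(t_1,\xi^{(1)};\dots;t_M,\xi^{(M)})\big]=p_\nu^{N\delta_0}(t_1+\sigma^2,\xi^{(1)};\dots;t_M+\sigma^2,\xi^{(M)}).$$ (3) Consequently, if $(\Xi(t))_{t\ge0}$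 is a noncolliding Brownian motion with initial law $\mu_{N,\sigma^2}$ and $(\Xi'(t))_{t\ge0}$ is one started from $N\delta_0$, then $(\Xi(t))_{t\ge0}$ and $(\Xi'(t+\sigma^2))_{t\ge0}$ have the same finite-dimensional distributions; for every $\nu>-1$ the same holds for the noncolliding squared Bessel process of index $\nu$, with $\mu^{(\nu)}_{N,\sigma^2}$ in place of $\mu_{N,\sigma^2}$. Here a process of either kind with a given initial law means a configuration-valued process whose initial configuration has that law and which, given its initial configuration $\xi$, has the multitime densities $p^\xi$, respectively $p^\xi_\nu$. -/

import Mathlib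

open MeasureTheory
open scoped NNReal ENNReal Real

noncomputable section

namespace NoncollidingDiffusion

/-! ### Configurations, Weyl chambers, random matrix densities -/

/-- The Weyl chamber `x₁ < x₂ < ⋯ < x_N` of type A. -/
def weylA (N : ℕ) : Set (Fin N → ℝ) := {x | StrictMono x}

/-- The chamber `0 ≤ x₁ < x₂ < ⋯ < x_N`. -/
def weylPos (N : ℕ) : Set (Fin N → ℝ) := {x | StrictMono x ∧ ∀ j, 0 ≤ x j}

/-- The configuration `∑ⱼ δ_{xⱼ}`, a counting measure on the line. -/
def config {N : ℕ} (x : Fin N → ℝ) : Measure ℝ := ∑ j, Measure.dirac (x j)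

/-- The Vandermonde product `h_N(x) = ∏_{j<k} (x_k - x_j)`. -/
def vandermondeProd {N : ℕ} (x : Fin N → ℝ) : ℝ :=
  ∏ j : Fin N, ∏ k ∈ Finset.Ioi j, (x k - x j)

/-- The probability density, on `weylA N`, of the ordered eigenvalues of the GUE with
variance `σ²`. -/
def guePdf {N : ℕ} (σ : ℝ) (x : Fin N → ℝ) : ℝ :=
  (σ ^ (N ^ 2))⁻¹ / ((2 * π) ^ ((N : ℝ) / 2) * ∏ j : Fin N, Real.Gamma ((j : ℝ) + 1))
    * Real.exp (-(∑ j, x j ^ 2) / (2 * σ ^ 2)) * vandermondeProd x ^ 2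

/-- The chGUE-type probability density on `weylPos N` with index `ν > -1` and variance `σ²`. -/
def chguePdf {N : ℕ} (ν σ : ℝ) (x : Fin N → ℝ) : ℝ :=
  σ ^ (-(2 * N * (N + ν)))
      / (2 ^ ((N : ℝ) * (N + ν))
          * ∏ j : Fin N, (Real.Gamma ((j : ℝ) + 1) * Real.Gamma ((j : ℝ) + 1 + ν)))
    * (∏ j, (x j ^ ν * Real.exp (-(x j) / (2 * σ ^ 2)))) * vandermondeProd x ^ 2

/-- Expectation of `F(Ξ)` for `Ξ` distributed according to the GUE density. The configuration is
represented by its increasing sequence of points. -/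
def gueExpect {N : ℕ} (σ : ℝ) (F : (Fin N → ℝ) → ℂ) : ℂ :=
  ∫ a in weylA N, F a * (guePdf σ a : ℂ)

/-- Expectation of `F(Ξ)` for `Ξ` distributed according to the chGUE-type density. -/
def chgueExpect {N : ℕ} (ν σ : ℝ) (F : (Fin N → ℝ) → ℂ) : ℂ :=
  ∫ a in weylPos N, F a * (chguePdf ν σ a : ℂ)

/-- The GUE law as a measure on tuples (carried by `weylA N`). -/
def gueLaw (N : ℕ) (σ : ℝ) : Measure (Fin N → ℝ) :=
  (volume.restrict (weylA N)).withDensity fun a => ENNReal.ofReal (guePdf σ a)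

/-- The chGUE-type law as a measure on tuples (carried by `weylPos N`). -/
def chgueLaw (N : ℕ) (ν σ : ℝ) : Measure (Fin N → ℝ) :=
  (volume.restrict (weylPos N)).withDensity fun a => ENNReal.ofReal (chguePdf ν σ a)

/-! ### One-particle kernels -/

/-- `p(t, y|x)`, used only for `t ≠ 0`; for `t > 0` and real `x`, `y` it is the transition density
of Brownian motion from `x` to `y`. -/
def bmKernel (t : ℝ) (y x : ℂ) : ℂ :=
  1 / ((√(2 * π * |t|) : ℝ) : ℂ) * Complex.exp (-((x - y) ^ 2 / (2 * t)))

/-- The modified Bessel function of the first kind, with principal powers. -/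
def besselI (ν : ℝ) (z : ℂ) : ℂ :=
  ∑' n : ℕ, 1 / ((Real.Gamma (n + 1) * Real.Gamma (n + 1 + ν) : ℝ) : ℂ)
    * (z / 2) ^ (2 * n + ν : ℂ)

/-- `p^{(ν)}(t, y|x)`, used only for `t ≠ 0`; for `t > 0` and `x, y ≥ 0` it is the transition
density of the squared Bessel process of index `ν` from `x` to `y` (reflected at `0` if `ν < 0`).
All complex powers are principal. -/
def besqKernel (ν t : ℝ) (y x : ℂ) : ℂ :=
  if x = 0 then
    y ^ (ν : ℂ) / (((2 * |t|) ^ (ν + 1) * Real.Gamma (ν + 1) : ℝ) : ℂ) * Complex.exp (-y / (2 * t))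
  else
    1 / ((2 * |t| : ℝ) : ℂ) * (y / x) ^ (ν / 2 : ℂ) * Complex.exp (-(x + y) / (2 * t))
      * besselI ν ((x * y) ^ (1 / 2 : ℂ) / t)

/-- Karlin–McGregor determinant of Brownian motion, `f(t, y|x)`. -/
def bmKM {N : ℕ} (t : ℝ) (y x : Fin N → ℝ) : ℂ :=
  Matrix.det (Matrix.of fun j k : Fin N => bmKernel t (y j) (x k))

/-- Karlin–McGregor determinant of the squared Bessel process, `f^{(ν)}(t, y|x)`. -/
def besqKM {N : ℕ} (ν t : ℝ) (y x : Fin N → ℝ) : ℂ :=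
  Matrix.det (Matrix.of fun j k : Fin N => besqKernel ν t (y j) (x k))

/-! ### The functions `φ_n^{(±)}` and `h_N^{(±)}`

The configuration `ξ = ∑ δ_{a_j}` is given by its points `a₁ ≤ ⋯ ≤ a_N`. -/

/-- `∏_{a ∈ ξ_n} (s - a)`, where `ξ_n` consists of the first `n` points. -/
def pointProd {N : ℕ} (a : Fin N → ℝ) (n : ℕ) (s : ℂ) : ℂ :=
  ∏ j ∈ Finset.univ.filter (fun j : Fin N => (j : ℕ) < n), (s - a j)

/-- Radius of a circle about `0` that encircles all points. -/
def contourRadius {N : ℕ} (a : Fin N → ℝ) : ℝ := 1 + ∑ j, |a j|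

def bmPhiPlus {N : ℕ} (a : Fin N → ℝ) (n : ℕ) (t : ℝ) (x : ℂ) : ℂ :=
  1 / (2 * π * Complex.I)
    * ∮ s in C(0, contourRadius a), bmKernel t x s * (1 / pointProd a (n + 1) s)

def bmPhiMinus {N : ℕ} (a : Fin N → ℝ) (n : ℕ) (t : ℝ) (x : ℂ) : ℂ :=
  ∫ s : ℝ, bmKernel (-t) (Complex.I * s) x * pointProd a n (Complex.I * s)

def besqPhiPlus {N : ℕ} (ν : ℝ) (a : Fin N → ℝ) (n : ℕ) (t : ℝ) (x : ℂ) : ℂ :=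
  1 / (2 * π * Complex.I)
    * ∮ s in C(0, contourRadius a), besqKernel ν t x s * (1 / pointProd a (n + 1) s)

def besqPhiMinus {N : ℕ} (ν : ℝ) (a : Fin N → ℝ) (n : ℕ) (t : ℝ) (x : ℂ) : ℂ :=
  ∫ s in Set.Iic (0 : ℝ), besqKernel ν (-t) s x * pointProd a n s

def bmHPlus {N : ℕ} (t : ℝ) (y a : Fin N → ℝ) : ℂ :=
  Matrix.det (Matrix.of fun j k : Fin N => bmPhiPlus a j t (y k))

def bmHMinus {N : ℕ} (t : ℝ) (y a : Fin N → ℝ) : ℂ :=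
  Matrix.det (Matrix.of fun j k : Fin N => bmPhiMinus a j t (y k))

def besqHPlus {N : ℕ} (ν t : ℝ) (y a : Fin N → ℝ) : ℂ :=
  Matrix.det (Matrix.of fun j k : Fin N => besqPhiPlus ν a j t (y k))

def besqHMinus {N : ℕ} (ν t : ℝ) (y a : Fin N → ℝ) : ℂ :=
  Matrix.det (Matrix.of fun j k : Fin N => besqPhiMinus ν a j t (y k))

/-! ### Multitime densities -/

/-- Multitime probability density of the noncolliding Brownian motion started from
`∑ δ_{a_j}`, at times `t 0 < ⋯ < t M` and configurations `x 0, …, x M ∈ weylA N`. -/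
def bmDensity {N : ℕ} (a : Fin N → ℝ) {M : ℕ} (t : Fin (M + 1) → ℝ)
    (x : Fin (M + 1) → Fin N → ℝ) : ℂ :=
  bmHMinus (t (Fin.last M)) (x (Fin.last M)) a
    * (∏ m : Fin M, bmKM (t m.succ - t m.castSucc) (x m.succ) (x m.castSucc))
    * bmHPlus (t 0) (x 0) a

/-- Multitime probability density of the noncolliding squared Bessel process of index `ν`
started from `∑ δ_{a_j}`. -/
def besqDensity {N : ℕ} (ν : ℝ) (a : Fin N → ℝ) {M : ℕ} (t : Fin (M + 1) → ℝ)
    (x : Fin (M + 1) → Fin N → ℝ) : ℂ :=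
  besqHMinus ν (t (Fin.last M)) (x (Fin.last M)) a
    * (∏ m : Fin M, besqKM ν (t m.succ - t m.castSucc) (x m.succ) (x m.castSucc))
    * besqHPlus ν (t 0) (x 0) a

/-! ### The processes, through their finite-dimensional laws -/

/-- The measure `init(da) dens(a, x) dx` on initial tuples and `M + 1` later tuples in `W`. -/
def jointLaw {N M : ℕ} (W : Set (Fin N → ℝ)) (init : Measure (Fin N → ℝ))
    (dens : (Fin N → ℝ) → (Fin (M + 1) → Fin N → ℝ) → ℂ) :
    Measure ((Fin N → ℝ) × (Fin (M + 1) → Fin N → ℝ)) :=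
  (init.prod (volume.restrict {x | ∀ m, x m ∈ W})).withDensity
    fun z => ENNReal.ofReal (dens z.1 z.2).re

/-- `X` is a configuration-valued process whose initial configuration has law `init` and which,
given its initial configuration `∑ δ_{a_j}`, has multitime densities `dens a` on `W`. -/
structure HasMultitimeDensities {N : ℕ} (W : Set (Fin N → ℝ))
    (dens : (Fin N → ℝ) → ∀ {M : ℕ}, (Fin (M + 1) → ℝ) → (Fin (M + 1) → Fin N → ℝ) → ℂ)
    (init : Measure (Fin N → ℝ)) {Ω : Type*} [MeasurableSpace Ω] (P : Measure Ω)
    (X : ℝ≥0 → Ω → Measure ℝ) : Prop where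
  measurable : ∀ t, Measurable (X t)
  law_zero : P.map (X 0) = init.map config
  law : ∀ (M : ℕ) (t : Fin (M + 1) → ℝ≥0), 0 < t 0 → StrictMono t →
    P.map (fun ω => (X 0 ω, fun m => X (t m) ω)) =
      (jointLaw W init fun a x => dens a (fun m => (t m : ℝ)) x).map
        fun z => (config z.1, fun m => config (z.2 m))

/-- `X` is, under `P`, a noncolliding Brownian motion with initial law `init`. -/
def IsNoncollidingBM {N : ℕ} (init : Measure (Fin N → ℝ)) {Ω : Type*} [MeasurableSpace Ω]
    (P : Measure Ω) (X : ℝ≥0 → Ω → Measure ℝ) : Prop :=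
  HasMultitimeDensities (weylA N) (fun a {_} t x => bmDensity a t x) init P X

/-- `X` is, under `P`, a noncolliding squared Bessel process of index `ν` with initial law
`init`. -/
def IsNoncollidingBESQ {N : ℕ} (ν : ℝ) (init : Measure (Fin N → ℝ)) {Ω : Type*}
    [MeasurableSpace Ω] (P : Measure Ω) (X : ℝ≥0 → Ω → Measure ℝ) : Prop :=
  HasMultitimeDensities (weylPos N) (fun a {_} t x => besqDensity ν a t x) init P X

end NoncollidingDiffusion

end

open NoncollidingDiffusion

/-!
Let `h` be the Vandermonde product and let `N δ₀` be the configuration with `N` points at `0`. For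
real `t > 0`, each multitime density is a product of three kinds of factors, of which only one
depends on the initial configuration.

* The factor `h_N^{(-)}` at the last time is the determinant of monic polynomials, since integration
  against the kernel with negative time maps monic polynomials to monic polynomials of the same
  degree. Hence it equals `h`, whatever the time and the initial configuration
  (`bmHMinus_eq`, `besqHMinus_eq`). For the squared Bessel process this holds up to a phase at
  configurations containing `0`, which cancels on both sides of an identity between densities and
  is invisible to the laws.
* The Karlin–McGregor determinants in the middle do not see the initial configuration, and depend
  on time differences only.
* The factor `h_N^{(+)}` at the first time is the Karlin–McGregor determinant divided by `h(a)` if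
  the initial points `a` are distinct, by partial fractions (`bmHPlus_mul_vandermondeProd`,
  `besqHPlus_mul_vandermondeProd`). For the initial configuration `N δ₀` it is a product of weights
  times a constant times `h` (`bmHPlus_zero`, `besqHPlus_zero`).

Consequently the initial density at `a` is `h(a)` times the factor `h_N^{(+)}` at `a` for `N δ₀` and
time `σ²` (`guePdf_eq`, `chguePdf_eq`). In the expectation the two factors `h(a)` combine with the
determinants, and Andréief's identity turns the integral into a determinant of one-dimensional
integrals. These convolve a kernel at time `t` with a polynomial times the weight at time `σ²`; the
result is a polynomial of the same degree times the weight at time `t + σ²`, and the determinant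
only retains the leading coefficients (`setIntegral_bmHPlus`, `setIntegral_besqHPlus`). This is the
identity of the multitime densities.

For the processes, the structure `IsKarlinMcGregorFamily` isolates what the two cases share. The
laws in `HasMultitimeDensities` are formed from positive parts of densities. At positive times, the
density of one law is at most that of the other by the identity just described, and as both laws
have total mass one, they coincide. If the time `0` occurs, the initial density times the multitime
density is itself a multitime density of the process started from `N δ₀`, with the additional time
`σ²`.
-/

namespace NoncollidingDiffusion

/-! ### Determinants of polynomials and of contour integrals -/

open Polynomial in
/-- If the rows of a matrix evaluate polynomials of degree at most `j` at the points `x k`, up to a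
common weight `g`, then column operations reduce its determinant to a Vandermonde determinant, and
only the coefficients of degree `j` survive. The polynomials need not be of exact degree, so a
vanishing `c j` is allowed. -/
theorem det_eval_of_natDegree_le {N : ℕ} (x : Fin N → ℝ) (g c : Fin N → ℂ)
    (A : Fin N → Fin N → ℂ)
    (hA : ∀ j : Fin N, ∃ p : ℂ[X], p.natDegree ≤ j ∧ p.coeff j = c j ∧
      ∀ k, A j k = g k * p.eval (x k : ℂ)) :
    Matrix.det (Matrix.of A) = (∏ k, g k) * (∏ j, c j) * (vandermondeProd x : ℂ) := by
  choose p hdeg hcoeff hA using hA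
  have hmat : (Matrix.of A).transpose = Matrix.of fun k j => g k *
      (Matrix.of fun k j => (p j).eval ((x k : ℝ) : ℂ)) k j := by
    ext k j
    simp [hA]
  rw [← Matrix.det_transpose, hmat, Matrix.det_mul_column,
    Matrix.eval_matrixOfPolynomials_eq_vandermonde_mul_matrixOfPolynomials _ p hdeg,
    Matrix.det_mul, Matrix.det_vandermonde, Matrix.det_of_isUpperTriangular]
  · simp [hcoeff, vandermondeProd]
    ring
  · intro i j hij
    simp only [Matrix.of_apply]
    exact coeff_eq_zero_of_natDegree_lt (lt_of_le_of_lt (hdeg j) hij)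

theorem norm_lt_contourRadius {N : ℕ} (a : Fin N → ℝ) (i : Fin N) :
    ‖(a i : ℂ)‖ < contourRadius a := by
  have := Finset.single_le_sum (f := fun j => |a j|) (fun j _ => abs_nonneg _) (Finset.mem_univ i)
  simp only [Complex.norm_real, Real.norm_eq_abs, contourRadius]
  linarith

theorem contourRadius_pos {N : ℕ} (a : Fin N → ℝ) : 0 < contourRadius a := by
  have : 0 ≤ ∑ j, |a j| := Finset.sum_nonneg fun j _ => abs_nonneg _
  unfold contourRadius
  linarith

/-- The contour integral against `1 / ∏ (s - a j)` is, by partial fractions and Cauchy's formula,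
the divided difference of `f` at the first `n` points. -/
theorem circleIntegral_inv_pointProd {N : ℕ} (a : Fin N → ℝ) (ha : Function.Injective a)
    (f : ℂ → ℂ) (hf : Differentiable ℂ f) (n : ℕ) (hn : 0 < n) (hN : 0 < N) :
    1 / (2 * π * Complex.I) * (∮ s in C(0, contourRadius a), f s * (1 / pointProd a n s)) =
      ∑ i ∈ Finset.univ.filter (fun j : Fin N => (j : ℕ) < n),
        Lagrange.nodalWeight (Finset.univ.filter (fun j : Fin N => (j : ℕ) < n))
          (fun j => (a j : ℂ)) i * f (a i) := by
  set S := Finset.univ.filter (fun j : Fin N => (j : ℕ) < n) with hS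
  have hne : ∀ s ∈ Metric.sphere (0 : ℂ) (contourRadius a), ∀ i, s ≠ (a i : ℂ) := by
    intro s hs i h
    have := norm_lt_contourRadius a i
    rw [← h] at this
    simp at hs
    linarith
  have hinj : Set.InjOn (fun j => (a j : ℂ)) S := by
    intro i _ j _ h
    exact ha (Complex.ofReal_injective h)
  have hSne : S.Nonempty := ⟨⟨0, hN⟩, by simp [hS, hn]⟩
  have hpf : ∀ s ∈ Metric.sphere (0 : ℂ) (contourRadius a),
      f s * (1 / pointProd a n s) = ∑ i ∈ S,
        Lagrange.nodalWeight S (fun j => (a j : ℂ)) i * ((s - a i)⁻¹ • f s) := by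
    intro s hs
    have h1 := Lagrange.eval_interpolate_not_at_node (s := S) (v := fun j => (a j : ℂ))
      (r := 1) (x := s) (fun i _ => hne s hs i)
    rw [Lagrange.interpolate_one hinj hSne, Polynomial.eval_one, Lagrange.eval_nodal] at h1
    have h2 : pointProd a n s ≠ 0 := Finset.prod_ne_zero_iff.2 fun i _ => sub_ne_zero.2 (hne s hs i)
    change 1 = pointProd a n s * _ at h1
    have h3 : 1 / pointProd a n s = ∑ i ∈ S,
        Lagrange.nodalWeight S (fun j => (a j : ℂ)) i * (s - a i)⁻¹ := by
      rw [div_eq_iff h2]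
      simpa [mul_comm] using h1
    rw [h3, Finset.mul_sum]
    refine Finset.sum_congr rfl fun i _ => ?_
    simp only [smul_eq_mul]
    ring
  rw [circleIntegral.integral_congr (contourRadius_pos a).le hpf, circleIntegral.integral_fun_sum]
  · rw [Finset.mul_sum]
    refine Finset.sum_congr rfl fun i _ => ?_
    rw [circleIntegral.integral_const_mul, DifferentiableOn.circleIntegral_sub_inv_smul
      (hf.differentiableOn) (by simpa using norm_lt_contourRadius a i)]
    have : (2 * π * Complex.I : ℂ) ≠ 0 := Complex.two_pi_I_ne_zero
    simp only [smul_eq_mul]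
    field_simp
  · intro i _
    refine ContinuousOn.circleIntegrable (contourRadius_pos a).le ?_
    refine continuousOn_const.mul (ContinuousOn.fun_smul ?_ hf.continuous.continuousOn)
    exact ContinuousOn.inv₀ (by fun_prop) fun s hs => sub_ne_zero.2 (hne s hs i)

/-- The matrix of divided differences is a lower triangular matrix times the matrix of values, and
the diagonal entries of the triangular factor multiply to the inverse of the Vandermonde product. -/
theorem det_circleIntegral_inv_pointProd {N : ℕ} (a : Fin N → ℝ) (ha : Function.Injective a)
    (f : Fin N → ℂ → ℂ) (hf : ∀ k, Differentiable ℂ (f k)) :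
    Matrix.det (Matrix.of fun j k : Fin N => 1 / (2 * π * Complex.I) *
      (∮ s in C(0, contourRadius a), f k s * (1 / pointProd a (j + 1) s))) *
        (vandermondeProd a : ℂ) = Matrix.det (Matrix.of fun j k : Fin N => f k (a j)) := by
  set W : Matrix (Fin N) (Fin N) ℂ := Matrix.of fun j i => if i ≤ j then
    Lagrange.nodalWeight (Finset.univ.filter (fun l : Fin N => (l : ℕ) < j + 1))
          (fun l => (a l : ℂ)) i else 0 with hW
  have hmat : (Matrix.of fun j k : Fin N => 1 / (2 * π * Complex.I) *
      (∮ s in C(0, contourRadius a), f k s * (1 / pointProd a (j + 1) s))) =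
      W * Matrix.of fun j k : Fin N => f k (a j) := by
    ext j k
    simp only [Matrix.of_apply, Matrix.mul_apply, hW]
    rw [circleIntegral_inv_pointProd a ha (f k) (hf k) _ (by simp) j.pos, Finset.sum_filter]
    refine Finset.sum_congr rfl fun i _ => ?_
    have : (i : ℕ) < j + 1 ↔ i ≤ j := by rw [Fin.le_def]; omega
    simp [this]
  have hdetW : W.det * (vandermondeProd a : ℂ) = 1 := by
    rw [Matrix.det_of_isLowerTriangular]
    · have hv : vandermondeProd a = ∏ k : Fin N, ∏ j ∈ Finset.Iio k, (a k - a j) := by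
        unfold vandermondeProd
        exact Finset.prod_comm' (by simp)
      rw [hv, Complex.ofReal_prod, ← Finset.prod_mul_distrib]
      refine Finset.prod_eq_one fun k _ => ?_
      have : (Finset.univ.filter (fun l : Fin N => (l : ℕ) < k + 1)).erase k = Finset.Iio k := by
        ext l
        simp only [Finset.mem_erase, Finset.mem_filter, Finset.mem_univ, true_and,
          Finset.mem_Iio, Fin.lt_def, ne_eq, Fin.ext_iff]
        omega
      simp only [hW, Matrix.of_apply, le_refl, if_true, Lagrange.nodalWeight, this,
        Complex.ofReal_prod, ← Finset.prod_mul_distrib]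
      refine Finset.prod_eq_one fun l hl => ?_
      rw [Complex.ofReal_sub]
      refine inv_mul_cancel₀ (sub_ne_zero.2 fun h => ?_)
      have := ha (Complex.ofReal_injective h)
      simp [this] at hl
    · intro i j hij
      have : ¬ j ≤ i := not_le.2 hij
      simp [hW, this]
  rw [hmat, Matrix.det_mul, mul_right_comm, hdetW, one_mul]

theorem differentiable_tsum_mul_pow (b : ℕ → ℂ)
    (hb : ∀ r : ℝ, 0 ≤ r → Summable fun m => ‖b m‖ * r ^ m) :
    Differentiable ℂ fun z : ℂ => ∑' m, b m * z ^ m := by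
  intro z
  have hz : z ∈ Metric.ball (0 : ℂ) (‖z‖ + 1) := by simp
  refine (Complex.differentiableOn_tsum_of_summable_norm (hb (‖z‖ + 1) (by positivity))
    (U := Metric.ball 0 (‖z‖ + 1)) (fun m => by fun_prop) Metric.isOpen_ball ?_).differentiableAt
      (Metric.isOpen_ball.mem_nhds hz)
  intro m w hw
  rw [norm_mul, norm_pow]
  have : ‖w‖ ≤ ‖z‖ + 1 := by simpa using (mem_ball_zero_iff.1 hw).le
  gcongr

theorem summable_mul_pow (b : ℕ → ℂ)
    (hb : ∀ r : ℝ, 0 ≤ r → Summable fun m => ‖b m‖ * r ^ m) (z : ℂ) :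
    Summable fun m => b m * z ^ m := by
  refine Summable.of_norm ?_
  simpa using hb ‖z‖ (norm_nonneg _)

open Polynomial in
/-- The confluent case, all points at `0`: the contour integral is the Taylor coefficient at `s = 0`
of order `n`, which is a polynomial in `y` of degree at most `n`. Its leading coefficient comes from
the series alone, since `E 0 = 1`. -/
theorem circleIntegral_mul_tsum_div_pow (E : ℂ → ℂ) (hE : Differentiable ℂ E) (hE0 : E 0 = 1)
    (b : ℕ → ℂ) (hb : ∀ r : ℝ, 0 ≤ r → Summable fun m => ‖b m‖ * r ^ m) (κ : ℂ) {R : ℝ}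
    (hR : 0 < R) (n : ℕ) :
    ∃ p : ℂ[X], p.natDegree ≤ n ∧ p.coeff n = b n * κ ^ n ∧
      ∀ y : ℂ, 1 / (2 * π * Complex.I) *
        (∮ s in C(0, R), E s * (∑' m, b m * (κ * (y * s)) ^ m) * (1 / s ^ (n + 1))) =
          p.eval y := by
  -- `e j` is the Taylor coefficient of `E` of order `j`.
  set e : ℕ → ℂ := fun j => 1 / (2 * π * Complex.I) * ∮ s in C(0, R), E s * (1 / s ^ (j + 1))
    with he
  have he0 : e 0 = 1 := by
    have := DifferentiableOn.circleIntegral_sub_inv_smul (c := 0) (R := R) (w := 0)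
      (hE.differentiableOn) (by simpa using hR)
    have h2 : (2 * π * Complex.I : ℂ) ≠ 0 := Complex.two_pi_I_ne_zero
    simp only [sub_zero, smul_eq_mul, hE0, mul_one] at this
    simp only [he, zero_add, pow_one, one_div, mul_comm (E _)]
    rw [this, inv_mul_cancel₀ h2]
  refine ⟨∑ m ∈ Finset.range (n + 1), monomial m (b m * κ ^ m * e (n - m)), ?_, ?_, fun y => ?_⟩
  · refine natDegree_sum_le_of_forall_le _ _ fun m hm => ?_
    exact (natDegree_monomial_le _).trans (Nat.lt_succ_iff.1 (Finset.mem_range.1 hm))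
  · simp [finsetSum_coeff, coeff_monomial, he0]
  · -- The tail of the series, from order `n + 1` on, cancels the pole and does not contribute.
    set T : ℂ → ℂ := fun z => ∑' m, b (m + (n + 1)) * z ^ m with hT
    have hTd : Differentiable ℂ T := by
      refine differentiable_tsum_mul_pow (fun m => b (m + (n + 1))) fun r hr => ?_
      rcases hr.eq_or_lt with rfl | hr
      · refine summable_of_ne_finset_zero (s := {0}) fun m hm => ?_
        simp at hm
        simp [hm]
      · have := ((summable_nat_add_iff (n + 1)).2 (hb r hr.le)).mul_right ((r ^ (n + 1))⁻¹)
        refine this.congr fun m => ?_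
        rw [pow_add]
        field_simp
    have hpt : ∀ s ∈ Metric.sphere (0 : ℂ) R,
        E s * (∑' m, b m * (κ * (y * s)) ^ m) * (1 / s ^ (n + 1)) =
        (∑ m ∈ Finset.range (n + 1), (b m * κ ^ m * y ^ m) * (E s * (1 / s ^ (n - m + 1)))) +
          E s * (κ * y) ^ (n + 1) * T (κ * (y * s)) := by
      intro s hs
      have hs0 : s ≠ 0 := by
        rintro rfl
        simp at hs
        exact hR.ne hs
      rw [← (summable_mul_pow b hb (κ * (y * s))).sum_add_tsum_nat_add (n + 1), mul_add, add_mul,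
        Finset.mul_sum, Finset.sum_mul]
      congr 1
      · refine Finset.sum_congr rfl fun m hm => ?_
        have hm' : m ≤ n := Nat.lt_succ_iff.1 (Finset.mem_range.1 hm)
        obtain ⟨l, rfl⟩ := Nat.exists_eq_add_of_le hm'
        rw [Nat.add_sub_cancel_left]
        have : s ^ (m + l + 1) = s ^ m * s ^ (l + 1) := by ring
        rw [this, mul_pow, mul_pow]
        field_simp
      · have : ∀ m, b (m + (n + 1)) * (κ * (y * s)) ^ (m + (n + 1)) =
            (b (m + (n + 1)) * (κ * (y * s)) ^ m) * (κ * (y * s)) ^ (n + 1) := fun m => by ring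
        simp_rw [this]
        rw [tsum_mul_right]
        simp only [hT]
        have h3 : (κ * (y * s)) ^ (n + 1) = (κ * y) ^ (n + 1) * s ^ (n + 1) := by ring
        rw [h3]
        field_simp
    have hci : ∀ m, CircleIntegrable (fun s => E s * (1 / s ^ m)) 0 R := by
      intro m
      refine ContinuousOn.circleIntegrable hR.le ?_
      refine hE.continuous.continuousOn.mul (ContinuousOn.div continuousOn_const (by fun_prop) ?_)
      intro s hs
      refine pow_ne_zero _ ?_
      rintro rfl
      simp at hs
      exact hR.ne hs
    have hd : Differentiable ℂ fun s => E s * (κ * y) ^ (n + 1) * T (κ * (y * s)) := by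
      refine (hE.mul_const _).mul (hTd.comp (by fun_prop))
    rw [circleIntegral.integral_congr hR.le hpt, circleIntegral.integral_add,
      circleIntegral.integral_fun_sum,
      Complex.circleIntegral_eq_zero_of_differentiable_on_off_countable hR.le
        Set.countable_empty hd.continuous.continuousOn (fun z _ => hd z), add_zero, Finset.mul_sum,
        eval_finsetSum]
    · refine Finset.sum_congr rfl fun m _ => ?_
      rw [circleIntegral.integral_const_mul, eval_monomial]
      simp only [he]
      ring
    · intro m _
      exact (hci _).const_fun_smul (a := (b m * κ ^ m * y ^ m))
    · exact CircleIntegrable.fun_sum _ fun m _ =>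
        (hci _).const_fun_smul (a := (b m * κ ^ m * y ^ m))
    · exact hd.continuous.continuousOn.circleIntegrable hR.le

theorem pointProd_zero {N : ℕ} {n : ℕ} (hn : n ≤ N) (s : ℂ) :
    pointProd (fun _ : Fin N => (0 : ℝ)) n s = s ^ n := by
  have : (Finset.univ.filter (fun j : Fin N => (j : ℕ) < n)).card = n := by
    rw [Fin.card_filter_val_lt]
    exact min_eq_right hn
  simp [pointProd, this]

open Polynomial in
theorem exists_polynomial_eq_pointProd {N : ℕ} (a : Fin N → ℝ) {n : ℕ} (hn : n ≤ N) :
    ∃ p : ℂ[X], p.natDegree = n ∧ p.coeff n = 1 ∧ ∀ s, pointProd a n s = p.eval s := by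
  have hcard : (Finset.univ.filter (fun j : Fin N => (j : ℕ) < n)).card = n := by
    rw [Fin.card_filter_val_lt]
    exact min_eq_right hn
  set p := ∏ j ∈ Finset.univ.filter (fun j : Fin N => (j : ℕ) < n), (X - C (a j : ℂ)) with hp
  have hdeg : p.natDegree = n := by
    rw [hp, natDegree_finsetProd_X_sub_C_eq_card, hcard]
  have hmon : p.Monic := monic_prod_of_monic _ _ fun j _ => monic_X_sub_C _
  refine ⟨p, hdeg, ?_, fun s => ?_⟩
  · simpa [hdeg] using hmon.coeff_natDegree
  · simp [hp, pointProd, eval_prod]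

open Polynomial in
/-- If the moments of `F` against powers of `z` are, up to a common factor `g`, monic polynomials in
a parameter `y`, then so are the integrals against the monic polynomials `pointProd a n`. The
polynomial `p` does not depend on `F`, `g` or `y`. -/
theorem exists_polynomial_integral_mul_pointProd {N : ℕ} (a : Fin N → ℝ) {n : ℕ} (hn : n ≤ N)
    (μ : Measure ℝ) (z : ℝ → ℂ) (q : ℕ → ℂ[X]) (hq : ∀ k, (q k).natDegree ≤ k)
    (hq1 : ∀ k, (q k).coeff k = 1) :
    ∃ p : ℂ[X], p.natDegree ≤ n ∧ p.coeff n = 1 ∧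
      ∀ (F : ℝ → ℂ) (g y : ℂ), (∀ k, Integrable (fun s => F s * z s ^ k) μ) →
        (∀ k, ∫ s, F s * z s ^ k ∂μ = g * (q k).eval y) →
        ∫ s, F s * pointProd a n (z s) ∂μ = g * p.eval y := by
  obtain ⟨P, hP, hP1, hPe⟩ := exists_polynomial_eq_pointProd a hn
  refine ⟨∑ k ∈ Finset.range (n + 1), C (P.coeff k) * q k, ?_, ?_, fun F g y hint hval => ?_⟩
  · refine natDegree_sum_le_of_forall_le _ _ fun m hm => ?_
    refine (natDegree_C_mul_le _ _).trans ((hq m).trans ?_)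
    exact (Nat.lt_succ_iff.1 (Finset.mem_range.1 hm))
  · rw [finsetSum_coeff, Finset.sum_range_succ, Finset.sum_eq_zero]
    · simp [hP1, hq1]
    · intro m hm
      rw [coeff_C_mul, coeff_eq_zero_of_natDegree_lt (p := q m), mul_zero]
      exact lt_of_le_of_lt (hq m) (Finset.mem_range.1 hm)
  · simp_rw [hPe, eval_eq_sum_range (p := P), hP, Finset.mul_sum]
    rw [integral_finsetSum]
    · rw [eval_finsetSum, Finset.mul_sum]
      refine Finset.sum_congr rfl fun k _ => ?_
      simp_rw [mul_left_comm (F _)]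
      rw [integral_const_mul, hval]
      simp
      ring
    · intro k _
      simp_rw [mul_left_comm (F _)]
      exact (hint k).const_mul _

/-! ### Andréief's identity on Weyl chambers -/

theorem measurableSet_weylA (N : ℕ) : MeasurableSet (weylA N) := by
  have : weylA N = ⋂ i : Fin N, ⋂ j : Fin N, ⋂ _ : i < j, {x | x i < x j} := by
    ext x
    simp [weylA, StrictMono]
  rw [this]
  exact MeasurableSet.iInter fun i => MeasurableSet.iInter fun j => MeasurableSet.iInter fun _ =>
    measurableSet_lt (measurable_pi_apply i) (measurable_pi_apply j)

theorem measurableSet_weylPos (N : ℕ) : MeasurableSet (weylPos N) := by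
  have : weylPos N = weylA N ∩ ⋂ j : Fin N, {x | 0 ≤ x j} := by
    ext x
    simp [weylA, weylPos]
  rw [this]
  exact (measurableSet_weylA N).inter <| MeasurableSet.iInter fun j =>
    measurableSet_le measurable_const (measurable_pi_apply j)

theorem ae_injective (N : ℕ) : ∀ᵐ a : Fin N → ℝ, Function.Injective a := by
  have h : ∀ i j : Fin N, ∀ᵐ a : Fin N → ℝ, i ≠ j → a i ≠ a j := by
    intro i j
    by_cases hij : i = j
    · simp [hij]
    · set L : (Fin N → ℝ) →ₗ[ℝ] ℝ :=
        (LinearMap.proj i : (Fin N → ℝ) →ₗ[ℝ] ℝ) - (LinearMap.proj j : (Fin N → ℝ) →ₗ[ℝ] ℝ)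
      have hL : volume (LinearMap.ker L : Set (Fin N → ℝ)) = 0 := by
        refine Measure.addHaar_submodule _ _ fun h => ?_
        rw [LinearMap.ker_eq_top] at h
        have := LinearMap.congr_fun h (Pi.single i 1)
        simp [L, Ne.symm hij] at this
      filter_upwards [measure_eq_zero_iff_ae_notMem.1 hL] with a ha _ hEq
      exact ha (by simp [L, hEq])
  filter_upwards [ae_all_iff.2 fun i => ae_all_iff.2 fun j => h i j] with a ha i j hij
  by_contra hne
  exact ha i j hne hij

/-- The tuples obtained from increasing ones by permuting the entries by `τ`: `b = a ∘ τ` with `a`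
in the Weyl chamber. -/
def weylImage {N : ℕ} (τ : Equiv.Perm (Fin N)) : Set (Fin N → ℝ) :=
  {b | b ∘ τ.symm ∈ weylA N}

theorem measurableSet_weylImage {N : ℕ} (τ : Equiv.Perm (Fin N)) :
    MeasurableSet (weylImage τ) := by
  refine measurableSet_preimage (f := fun b : Fin N → ℝ => b ∘ τ.symm) ?_ (measurableSet_weylA N)
  exact measurable_pi_lambda _ fun i => measurable_pi_apply _

theorem pairwise_disjoint_weylImage (N : ℕ) :
    Pairwise (Function.onFun Disjoint (weylImage (N := N))) := by
  intro τ τ' hne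
  refine Set.disjoint_left.2 fun b hb hb' => hne ?_
  have hb1 : StrictMono (b ∘ τ.symm) := hb
  have hb2 : StrictMono (b ∘ τ'.symm) := hb'
  have hr : Set.range (b ∘ τ.symm) = Set.range (b ∘ τ'.symm) := by
    rw [τ.symm.surjective.range_comp, τ'.symm.surjective.range_comp]
  have hEq := (StrictMono.range_inj hb1 hb2).1 hr
  have hinj : Function.Injective b := by
    have := hb1.injective.comp τ.injective
    simpa [Function.comp_assoc] using this
  have : τ.symm = τ'.symm := by
    ext i
    exact congrArg _ (hinj (congrFun hEq i))
  exact Equiv.symm_bijective.injective this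

theorem iUnion_weylImage_ae_eq_univ (N : ℕ) :
    (⋃ τ, weylImage (N := N) τ) =ᵐ[volume] Set.univ := by
  refine Filter.eventuallyEq_univ.2 ?_
  filter_upwards [ae_injective N] with a ha
  refine Set.mem_iUnion.2 ⟨(Tuple.sort a).symm, ?_⟩
  exact (Tuple.monotone_sort a).strictMono_of_injective (ha.comp (Tuple.sort a).injective)

theorem measurePreserving_comp_perm {N : ℕ} (τ : Equiv.Perm (Fin N)) :
    MeasurePreserving (fun a : Fin N → ℝ => a ∘ τ) volume volume := by
  have := volume_measurePreserving_piCongrLeft (fun _ : Fin N => ℝ) τ.symm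
  convert this using 1
  ext a i
  have h := Equiv.piCongrLeft_apply_apply (P := fun _ : Fin N => ℝ) τ.symm a (τ i)
  simp only [Equiv.symm_apply_apply] at h
  exact h.symm

/-- Up to a null set, the images of the Weyl chamber under permutations of coordinates partition the
whole space. -/
theorem integral_weylA_sum_perm {N : ℕ} (F : (Fin N → ℝ) → ℂ) (hF : Integrable F) :
    IntegrableOn (fun a => ∑ τ : Equiv.Perm (Fin N), F (a ∘ τ)) (weylA N) ∧
      ∫ a in weylA N, ∑ τ : Equiv.Perm (Fin N), F (a ∘ τ) = ∫ a, F a := by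
  have hint : ∀ τ : Equiv.Perm (Fin N), IntegrableOn (fun a => F (a ∘ τ)) (weylA N) := fun τ =>
    ((measurePreserving_comp_perm τ).integrable_comp_of_integrable hF).integrableOn
  refine ⟨integrable_finsetSum _ fun τ _ => hint τ, ?_⟩
  rw [integral_finsetSum _ fun τ _ => hint τ]
  have hW : ∀ τ : Equiv.Perm (Fin N), ∫ a in weylA N, F (a ∘ τ) = ∫ a in weylImage τ, F a := by
    intro τ
    have hemb : MeasurableEmbedding (fun a : Fin N → ℝ => a ∘ τ) := by
      have h : (fun a : Fin N → ℝ => a ∘ τ) =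
          MeasurableEquiv.piCongrLeft (fun _ : Fin N => ℝ) τ.symm := by
        ext a i
        have h := Equiv.piCongrLeft_apply_apply (P := fun _ : Fin N => ℝ) τ.symm a (τ i)
        simp only [Equiv.symm_apply_apply] at h
        exact h.symm
      rw [h]
      exact MeasurableEquiv.measurableEmbedding _
    rw [← (measurePreserving_comp_perm τ).setIntegral_preimage_emb hemb F (weylImage τ)]
    congr 2
    ext a
    simp [weylImage, Function.comp_assoc]
  simp_rw [hW]
  rw [← integral_iUnion_fintype measurableSet_weylImage (pairwise_disjoint_weylImage N)
    fun τ => hF.integrableOn, setIntegral_congr_set (iUnion_weylImage_ae_eq_univ N),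
    setIntegral_univ]

/-- Andréief's identity. No factor `N!` appears because the integral is over the Weyl chamber. -/
theorem integral_weylA_det_mul_det {N : ℕ} (f g : Fin N → ℝ → ℂ)
    (hfg : ∀ i j, Integrable fun u => g j u * f i u) :
    IntegrableOn (fun a => Matrix.det (Matrix.of fun j k => g k (a j)) *
        Matrix.det (Matrix.of fun i j => f i (a j))) (weylA N) ∧
      ∫ a in weylA N, Matrix.det (Matrix.of fun j k => g k (a j)) *
        Matrix.det (Matrix.of fun i j => f i (a j)) =
      Matrix.det (Matrix.of fun i j => ∫ u, g j u * f i u) := by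
  -- The first determinant symmetrizes `F`, as the second one is alternating.
  set F : (Fin N → ℝ) → ℂ := fun a => (∏ j, g j (a j)) *
    Matrix.det (Matrix.of fun i j => f i (a j)) with hFdef
  have hF1 : ∀ a, F a = ∑ ρ : Equiv.Perm (Fin N), ((Equiv.Perm.sign ρ : ℤ) : ℂ) *
      ∏ j, (g j (a j) * f (ρ j) (a j)) := by
    intro a
    simp only [hFdef, Matrix.det_apply', Finset.mul_sum, Matrix.of_apply, Finset.prod_mul_distrib]
    refine Finset.sum_congr rfl fun ρ _ => ?_
    ring
  have hFi : ∀ ρ : Equiv.Perm (Fin N), Integrable fun a : Fin N → ℝ =>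
      ((Equiv.Perm.sign ρ : ℤ) : ℂ) * ∏ j, (g j (a j) * f (ρ j) (a j)) := fun ρ =>
    (Integrable.fintype_prod (f := fun j u => g j u * f (ρ j) u)
      (fun j => hfg (ρ j) j)).const_mul _
  have hFint : Integrable F := by
    rw [funext hF1]
    exact integrable_finsetSum _ fun ρ _ => hFi ρ
  have hFval : ∫ a, F a = Matrix.det (Matrix.of fun i j => ∫ u, g j u * f i u) := by
    rw [funext hF1, integral_finsetSum _ fun ρ _ => hFi ρ, Matrix.det_apply']
    refine Finset.sum_congr rfl fun ρ _ => ?_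
    rw [integral_const_mul, integral_fintype_prod_volume_eq_prod (fun j u => g j u * f (ρ j) u)]
    rfl
  have hsum : ∀ a : Fin N → ℝ, Matrix.det (Matrix.of fun j k => g k (a j)) *
      Matrix.det (Matrix.of fun i j => f i (a j)) = ∑ τ : Equiv.Perm (Fin N), F (a ∘ τ) := by
    intro a
    rw [Matrix.det_apply', Finset.sum_mul]
    refine Finset.sum_congr rfl fun τ _ => ?_
    have hperm := Matrix.det_permute' τ (Matrix.of fun i j => f i (a j))
    have hs : (Matrix.of fun i j => f i ((a ∘ τ) j)) =
        (Matrix.of fun i j => f i (a j)).submatrix id τ := by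
      ext i j
      rfl
    simp only [hFdef]
    rw [hs, hperm]
    simp only [Matrix.of_apply, Function.comp_apply]
    ring
  simp_rw [hsum]
  rw [← hFval]
  exact integral_weylA_sum_perm F hFint

/-- Andréief's identity on the nonnegative chamber: cut the functions `f i` off on the negative
half-line. -/
theorem integral_weylPos_det_mul_det {N : ℕ} (f g : Fin N → ℝ → ℂ)
    (hfg : ∀ i j, IntegrableOn (fun u => g j u * f i u) (Set.Ici 0)) :
    IntegrableOn (fun a => Matrix.det (Matrix.of fun j k => g k (a j)) *
        Matrix.det (Matrix.of fun i j => f i (a j))) (weylPos N) ∧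
      ∫ a in weylPos N, Matrix.det (Matrix.of fun j k => g k (a j)) *
        Matrix.det (Matrix.of fun i j => f i (a j)) =
      Matrix.det (Matrix.of fun i j => ∫ u in Set.Ici 0, g j u * f i u) := by
  have hmul : ∀ i j, (fun u => g j u * (Set.Ici (0 : ℝ)).indicator (f i) u) =
      (Set.Ici (0 : ℝ)).indicator (fun u => g j u * f i u) := by
    intro i j
    ext u
    by_cases hu : u ∈ Set.Ici (0 : ℝ) <;> simp [Set.indicator, hu]
  obtain ⟨h1, h2⟩ := integral_weylA_det_mul_det (fun i => (Set.Ici (0 : ℝ)).indicator (f i)) g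
    (fun i j => by rw [hmul]; exact (integrable_indicator_iff measurableSet_Ici).2 (hfg i j))
  have hP : MeasurableSet {a : Fin N → ℝ | ∀ j, 0 ≤ a j} := by
    simp only [Set.ofPred_forall]
    exact MeasurableSet.iInter fun j => measurableSet_le measurable_const (measurable_pi_apply j)
  have hpt : (fun a => Matrix.det (Matrix.of fun j k => g k (a j)) *
      Matrix.det (Matrix.of fun i j => (Set.Ici (0 : ℝ)).indicator (f i) (a j))) =
      {a : Fin N → ℝ | ∀ j, 0 ≤ a j}.indicator fun a =>
        Matrix.det (Matrix.of fun j k => g k (a j)) *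
        Matrix.det (Matrix.of fun i j => f i (a j)) := by
    ext a
    by_cases ha : ∀ j, 0 ≤ a j
    · simp [Set.indicator, ha]
    · have ha' := ha
      push Not at ha
      obtain ⟨j, hj⟩ := ha
      have hdet :
          Matrix.det (Matrix.of fun i j => (Set.Ici (0 : ℝ)).indicator (f i) (a j)) = 0 := by
        refine Matrix.det_eq_zero_of_column_eq_zero j fun i => ?_
        simp [Set.indicator, hj]
      rw [Set.indicator_of_notMem (by simpa using ha'), hdet, mul_zero]
  have hset : weylPos N = weylA N ∩ {a : Fin N → ℝ | ∀ j, 0 ≤ a j} := rfl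
  rw [hpt] at h1 h2
  rw [setIntegral_indicator hP, ← hset] at h2
  rw [IntegrableOn, integrable_indicator_iff hP, IntegrableOn, Measure.restrict_restrict hP,
    Set.inter_comm, ← hset] at h1
  refine ⟨h1, h2.trans ?_⟩
  congr 2
  ext i j
  rw [hmul, integral_indicator measurableSet_Ici]

/-! ### Noncolliding Brownian motion -/

theorem integrable_pow_mul_cexp_quadratic {b : ℝ} (hb : 0 < b) (k : ℕ) (c : ℂ) :
    Integrable fun s : ℝ => (s : ℂ) ^ k * Complex.exp (-b * s ^ 2 + c * s) := by
  have hb' : 0 < (b : ℂ).re := by simpa using hb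
  have h1 := (integrable_cexp_quadratic hb' (c + 1) 0).norm
  have h2 := (integrable_cexp_quadratic hb' (c - 1) 0).norm
  refine ((h1.add h2).const_mul (k.factorial : ℝ)).mono' (by fun_prop) ?_
  refine Filter.Eventually.of_forall fun s => ?_
  have hk := Real.pow_div_factorial_le_exp |s| (abs_nonneg s) k
  rw [div_le_iff₀ (by positivity)] at hk
  have he : Real.exp |s| ≤ Real.exp s + Real.exp (-s) := by
    rcases abs_cases s with ⟨h, _⟩ | ⟨h, _⟩ <;> rw [h]
    · linarith [Real.exp_pos (-s)]
    · linarith [Real.exp_pos s]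
  have e1 : ‖Complex.exp (-b * s ^ 2 + (c + 1) * s + 0)‖ =
      ‖Complex.exp (-b * s ^ 2 + c * s)‖ * Real.exp s := by
    rw [Complex.norm_exp, Complex.norm_exp, ← Real.exp_add]
    simp
    ring_nf
  have e2 : ‖Complex.exp (-b * s ^ 2 + (c - 1) * s + 0)‖ =
      ‖Complex.exp (-b * s ^ 2 + c * s)‖ * Real.exp (-s) := by
    rw [Complex.norm_exp, Complex.norm_exp, ← Real.exp_add]
    simp
    ring_nf
  simp only [Pi.add_apply, e1, e2, norm_mul, norm_pow, Complex.norm_real, Real.norm_eq_abs]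
  have := norm_nonneg (Complex.exp (-b * s ^ 2 + c * s))
  calc |s| ^ k * ‖Complex.exp (-b * s ^ 2 + c * s)‖
      ≤ (Real.exp |s| * k.factorial) * ‖Complex.exp (-b * s ^ 2 + c * s)‖ := by gcongr
    _ ≤ ((Real.exp s + Real.exp (-s)) * k.factorial) * ‖Complex.exp (-b * s ^ 2 + c * s)‖ := by
        gcongr
    _ = _ := by ring

/-- Integration by parts. For `k = 0` the last term vanishes through its factor `k`, so that the
truncated exponent `k - 1` is harmless. -/
theorem integral_pow_mul_cexp_quadratic_succ {b : ℝ} (hb : 0 < b) (k : ℕ) (c : ℂ) :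
    ∫ s : ℝ, (s : ℂ) ^ (k + 1) * Complex.exp (-b * s ^ 2 + c * s) =
      c / (2 * b) * (∫ s : ℝ, (s : ℂ) ^ k * Complex.exp (-b * s ^ 2 + c * s)) +
      k / (2 * b) * ∫ s : ℝ, (s : ℂ) ^ (k - 1) * Complex.exp (-b * s ^ 2 + c * s) := by
  have hi := fun k => integrable_pow_mul_cexp_quadratic hb k c
  have hb0 : (b : ℂ) ≠ 0 := by exact_mod_cast hb.ne'
  have huv : (fun s : ℝ => (s : ℂ) ^ k * (Complex.exp (-b * s ^ 2 + c * s) * (-2 * b * s + c))) =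
      fun s : ℝ => (-2 * b) * ((s : ℂ) ^ (k + 1) * Complex.exp (-b * s ^ 2 + c * s)) +
        c * ((s : ℂ) ^ k * Complex.exp (-b * s ^ 2 + c * s)) := by
    ext s
    ring
  have hvu : (fun s : ℝ => ((k : ℂ) * (s : ℂ) ^ (k - 1)) * Complex.exp (-b * s ^ 2 + c * s)) =
      fun s : ℝ => (k : ℂ) * ((s : ℂ) ^ (k - 1) * Complex.exp (-b * s ^ 2 + c * s)) := by
    ext s
    ring
  have key := integral_mul_deriv_eq_deriv_mul_of_integrable
    (u := fun s : ℝ => (s : ℂ) ^ k) (u' := fun s : ℝ => (k : ℂ) * (s : ℂ) ^ (k - 1))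
    (v := fun s : ℝ => Complex.exp (-b * s ^ 2 + c * s))
    (v' := fun s : ℝ => Complex.exp (-b * s ^ 2 + c * s) * (-2 * b * s + c))
    (fun s _ => by simpa using (hasDerivAt_pow k (s : ℂ)).comp_ofReal)
    (fun s _ => by
      have h : HasDerivAt (fun z : ℂ => -b * z ^ 2 + c * z) (-2 * b * s + c) (s : ℂ) := by
        have h1 := ((hasDerivAt_pow 2 (s : ℂ)).const_mul (-b : ℂ)).add
          ((hasDerivAt_id (s : ℂ)).const_mul c)
        exact h1.congr_deriv (by norm_num; ring)
      exact (h.cexp).comp_ofReal)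
    (by
      change Integrable fun s : ℝ =>
        (s : ℂ) ^ k * (Complex.exp (-b * s ^ 2 + c * s) * (-2 * b * s + c))
      rw [huv]
      exact ((hi _).const_mul _).add ((hi _).const_mul _))
    (by
      change Integrable fun s : ℝ =>
        ((k : ℂ) * (s : ℂ) ^ (k - 1)) * Complex.exp (-b * s ^ 2 + c * s)
      rw [hvu]
      exact (hi _).const_mul _)
    (hi k)
  rw [huv, hvu, integral_add ((hi _).const_mul _) ((hi _).const_mul _), integral_const_mul,
    integral_const_mul, integral_const_mul] at key
  have hsolve : ∀ A B D : ℂ, -2 * b * A + c * B = -(k * D) →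
      A = c / (2 * b) * B + k / (2 * b) * D := by
    intro A B D h
    field_simp
    linear_combination -h
  exact hsolve _ _ _ key

open Polynomial in
/-- The moments of a tilted Gaussian are polynomials in the tilt, of Hermite type. -/
theorem exists_polynomial_gaussian_moment {b : ℝ} (hb : 0 < b) (k : ℕ) :
    ∃ q : ℂ[X], q.natDegree ≤ k ∧ q.coeff k = (1 / (2 * b)) ^ k ∧
      ∀ c : ℂ, ∫ s : ℝ, (s : ℂ) ^ k * Complex.exp (-b * s ^ 2 + c * s) =
        (π / b) ^ (1 / 2 : ℂ) * Complex.exp (c ^ 2 / (4 * b)) * q.eval c := by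
  induction k using Nat.strong_induction_on with
  | _ k ih =>
    rcases k with _ | k
    · refine ⟨1, by simp, by simp, fun c => ?_⟩
      have hb' : (-b : ℂ).re < 0 := by simpa using hb
      have := integral_cexp_quadratic hb' c 0
      simp only [add_zero, neg_neg, mul_neg, div_neg, zero_sub] at this
      simpa using this
    · obtain ⟨q, hq1, hq2, hq3⟩ := ih k (Nat.lt_succ_self k)
      obtain ⟨r, hr1, hr3⟩ : ∃ r : ℂ[X], r.natDegree ≤ k ∧ ∀ c : ℂ,
          k * ∫ s : ℝ, (s : ℂ) ^ (k - 1) * Complex.exp (-b * s ^ 2 + c * s) =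
          (π / b) ^ (1 / 2 : ℂ) * Complex.exp (c ^ 2 / (4 * b)) * r.eval c := by
        rcases k with _ | k
        · exact ⟨0, by simp, by simp⟩
        · obtain ⟨r, hr1, _, hr3⟩ := ih k (by omega)
          refine ⟨C ((k : ℂ) + 1) * r, (natDegree_C_mul_le _ _).trans (by omega), fun c => ?_⟩
          rw [Nat.add_sub_cancel, hr3]
          simp
          ring
      refine ⟨C (1 / (2 * b : ℂ)) * (X * q) + C (1 / (2 * b : ℂ)) * r, ?_, ?_, fun c => ?_⟩
      · refine natDegree_add_le_of_degree_le ((natDegree_C_mul_le _ _).trans ?_)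
          ((natDegree_C_mul_le _ _).trans (by omega))
        exact natDegree_mul_le.trans (by rw [natDegree_X]; omega)
      · rw [coeff_add, coeff_C_mul, coeff_C_mul, coeff_X_mul, hq2,
          coeff_eq_zero_of_natDegree_lt (p := r) (by omega), mul_zero, add_zero]
        ring
      · rw [integral_pow_mul_cexp_quadratic_succ hb, hq3]
        have := hr3 c
        simp only [eval_add, eval_mul, eval_C, eval_X]
        linear_combination (1 / (2 * b : ℂ)) * this

theorem bmKernel_of_pos {t : ℝ} (ht : 0 < t) (y x : ℂ) :
    bmKernel t y x = 1 / (√(2 * π * t) : ℝ) * Complex.exp (-(x - y) ^ 2 / (2 * t)) := by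
  rw [bmKernel, abs_of_pos ht, neg_div]

theorem ofReal_sqrt_eq_cpow {x : ℝ} (hx : 0 < x) :
    ((√x : ℝ) : ℂ) = (x : ℂ) ^ (1 / 2 : ℂ) := by
  rw [Real.sqrt_eq_rpow, Complex.ofReal_cpow hx.le]
  norm_num

open Polynomial in
/-- The inverse heat flow maps a monic polynomial to a monic polynomial of the same degree. -/
theorem bmPhiMinus_eq {N : ℕ} (a : Fin N → ℝ) {n : ℕ} (hn : n ≤ N) {t : ℝ} (ht : 0 < t) :
    ∃ p : ℂ[X], p.natDegree ≤ n ∧ p.coeff n = 1 ∧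
      ∀ x : ℂ, bmPhiMinus a n t x = p.eval x := by
  have htc : (t : ℂ) ≠ 0 := by exact_mod_cast ht.ne'
  have hb : 0 < 1 / (2 * t) := by positivity
  choose q hq1 hq2 hq3 using exists_polynomial_gaussian_moment hb
  obtain ⟨p, hp1, hp2, hp3⟩ := exists_polynomial_integral_mul_pointProd a hn volume
    (fun s => Complex.I * s)
    (fun k => C (Complex.I ^ k) * (q k).comp (C (-Complex.I / t) * X))
    (fun k => (natDegree_C_mul_le _ _).trans (natDegree_comp_le.trans (by
      calc (q k).natDegree * (C (-Complex.I / t) * X).natDegree ≤ k * 1 :=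
            Nat.mul_le_mul (hq1 k) ((natDegree_C_mul_le _ _).trans natDegree_X_le)
        _ = k := mul_one k)))
    (fun k => by
      rw [coeff_C_mul, comp_C_mul_X_coeff, hq2, ← mul_pow, ← mul_pow]
      have : Complex.I * (1 / (2 * ((1 / (2 * t) : ℝ) : ℂ)) * (-Complex.I / t)) = 1 := by
        push_cast
        field_simp
        simp
      rw [this, one_pow])
  refine ⟨p, hp1, hp2, fun x => ?_⟩
  have hK : ∀ s : ℝ, bmKernel (-t) (Complex.I * s) x =
      (1 / (√(2 * π * t) : ℝ) * Complex.exp (x ^ 2 / (2 * t))) *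
        Complex.exp (-((1 / (2 * t) : ℝ) : ℂ) * s ^ 2 + (-Complex.I / t * x) * s) := by
    intro s
    rw [bmKernel, abs_neg, abs_of_pos ht, mul_assoc (1 / _), ← Complex.exp_add]
    congr 2
    push_cast
    field_simp
    linear_combination s ^ 2 * Complex.I_sq
  have hF : ∀ (k : ℕ) (s : ℝ), bmKernel (-t) (Complex.I * s) x * (Complex.I * s) ^ k =
      (1 / (√(2 * π * t) : ℝ) * Complex.exp (x ^ 2 / (2 * t)) * Complex.I ^ k) *
      ((s : ℂ) ^ k *
        Complex.exp (-((1 / (2 * t) : ℝ) : ℂ) * s ^ 2 + (-Complex.I / t * x) * s)) := by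
    intro k s
    rw [hK]
    ring
  have h := hp3 (fun s => bmKernel (-t) (Complex.I * s) x) 1 x ?_ ?_
  · rw [bmPhiMinus, h, one_mul]
  · intro k
    simp_rw [hF]
    exact (integrable_pow_mul_cexp_quadratic hb k _).const_mul _
  · intro k
    simp_rw [hF]
    rw [integral_const_mul, hq3, ofReal_sqrt_eq_cpow (by positivity)]
    have e1 : (π / ((1 / (2 * t) : ℝ) : ℂ)) = ((2 * π * t : ℝ) : ℂ) := by
      push_cast
      field_simp
    have e2 : Complex.exp (x ^ 2 / (2 * t)) *
        Complex.exp ((-Complex.I / t * x) ^ 2 / (4 * ((1 / (2 * t) : ℝ) : ℂ))) = 1 := by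
      rw [← Complex.exp_add, ← Complex.exp_zero]
      congr 1
      push_cast
      field_simp
      rw [Complex.I_sq]
      ring
    have e3 : ((2 * π * t : ℝ) : ℂ) ^ (1 / 2 : ℂ) ≠ 0 := by
      rw [← ofReal_sqrt_eq_cpow (by positivity)]
      exact_mod_cast (Real.sqrt_pos.2 (by positivity)).ne'
    rw [e1]
    simp only [eval_mul, eval_C, eval_comp, eval_X, one_mul]
    rw [one_div, mul_assoc _⁻¹, mul_assoc _⁻¹, inv_mul_eq_iff_eq_mul₀ e3]
    linear_combination ((2 * π * t : ℝ) : ℂ) ^ (1 / 2 : ℂ) * Complex.I ^ k *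
      eval (-Complex.I / t * x) (q k) * e2

/-- The function `h_N^{(-)}` depends neither on the time nor on the initial configuration. -/
theorem bmHMinus_eq {N : ℕ} {t : ℝ} (ht : 0 < t) (y a : Fin N → ℝ) :
    bmHMinus t y a = (vandermondeProd y : ℂ) := by
  rw [bmHMinus, det_eval_of_natDegree_le y 1 1]
  · simp
  · intro j
    obtain ⟨p, h1, h2, h3⟩ := bmPhiMinus_eq a j.2.le ht
    exact ⟨p, h1, by simpa using h2, fun k => by simp [h3]⟩

theorem differentiable_bmKernel (t : ℝ) (y : ℂ) : Differentiable ℂ (bmKernel t y) := by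
  unfold bmKernel
  fun_prop

/-- For distinct initial points, `h_N^{(+)}` is the Karlin–McGregor determinant divided by the
Vandermonde product of these points. -/
theorem bmHPlus_mul_vandermondeProd {N : ℕ} (t : ℝ) (y a : Fin N → ℝ)
    (ha : Function.Injective a) :
    bmHPlus t y a * (vandermondeProd a : ℂ) =
      Matrix.det (Matrix.of fun j k : Fin N => bmKernel t (y k) (a j)) :=
  det_circleIntegral_inv_pointProd a ha (fun k => bmKernel t (y k))
    fun _ => differentiable_bmKernel t _

/-- The Gaussian density `p(t, y|0)` with variance `t > 0`, the common factor of `h_N^{(+)}` for the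
initial configuration `N δ₀`. -/
noncomputable def bmWeight (t : ℝ) (y : ℂ) : ℂ :=
  1 / (√(2 * π * t) : ℝ) * Complex.exp (-y ^ 2 / (2 * t))

/-- The leading coefficient `1 / (n! tⁿ)` of the `n`th Taylor coefficient of
`s ↦ p(t, y|s) / p(t, y|0)`, as a polynomial in `y`. -/
noncomputable def bmCoeff (t : ℝ) (n : ℕ) : ℂ := 1 / n.factorial * (1 / t) ^ n

theorem summable_inv_factorial_mul_pow (r : ℝ) (_ : 0 ≤ r) :
    Summable fun m : ℕ => ‖(1 / m.factorial : ℂ)‖ * r ^ m := by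
  refine (Real.summable_pow_div_factorial r).congr fun m => ?_
  simp
  ring

/-- The kernel as the weight in `y` times an entire function of `s` with value `1` at `0` times a
power series in `y s`, the shape to which `circleIntegral_mul_tsum_div_pow` applies. -/
theorem bmKernel_eq_weight_mul {t : ℝ} (ht : 0 < t) (y s : ℂ) :
    bmKernel t y s = bmWeight t y * (Complex.exp (-s ^ 2 / (2 * t)) *
      ∑' m : ℕ, (1 / m.factorial : ℂ) * (1 / t * (y * s)) ^ m) := by
  have htc : (t : ℂ) ≠ 0 := by exact_mod_cast ht.ne'
  have : ∑' m : ℕ, (1 / m.factorial : ℂ) * (1 / t * (y * s)) ^ m =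
      Complex.exp (1 / t * (y * s)) := by
    rw [Complex.exp_eq_exp_ℂ, NormedSpace.exp_eq_tsum_div]
    refine tsum_congr fun m => ?_
    ring
  rw [this, bmKernel_of_pos ht, bmWeight, mul_assoc (1 / _), ← Complex.exp_add, ← Complex.exp_add]
  congr 2
  field_simp
  ring

/-- For the initial configuration `N δ₀` the function `h_N^{(+)}` is the GUE density up to a
Vandermonde factor. -/
theorem bmHPlus_zero {N : ℕ} {t : ℝ} (ht : 0 < t) (y : Fin N → ℝ) :
    bmHPlus t y (fun _ => 0) = (∏ k, bmWeight t (y k)) * (∏ j : Fin N, bmCoeff t j) *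
      (vandermondeProd y : ℂ) := by
  rw [bmHPlus, det_eval_of_natDegree_le y]
  intro j
  obtain ⟨p, h1, h2, h3⟩ := circleIntegral_mul_tsum_div_pow
    (fun s => Complex.exp (-s ^ 2 / (2 * t))) (by fun_prop) (by simp)
    (fun m => (1 / m.factorial : ℂ)) summable_inv_factorial_mul_pow (1 / t)
    (contourRadius_pos (fun _ : Fin N => (0 : ℝ))) j
  refine ⟨p, h1, h2, fun k => ?_⟩
  rw [← h3, bmPhiPlus]
  simp_rw [pointProd_zero (Nat.succ_le_of_lt j.2), bmKernel_eq_weight_mul ht, mul_assoc]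
  rw [circleIntegral.integral_const_mul]
  ring

theorem bmHPlus_zero_eq_det {N : ℕ} {t : ℝ} (ht : 0 < t) (y : Fin N → ℝ) :
    bmHPlus t y (fun _ => 0) =
      Matrix.det (Matrix.of fun i j : Fin N =>
        bmCoeff t i * ((y j : ℂ) ^ (i : ℕ) * bmWeight t (y j))) := by
  rw [bmHPlus_zero ht, det_eval_of_natDegree_le y]
  intro j
  refine ⟨Polynomial.C (bmCoeff t j) * Polynomial.X ^ (j : ℕ),
    Polynomial.natDegree_C_mul_X_pow_le _ _, by simp, fun k => ?_⟩
  simp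
  ring

open Polynomial in
/-- The heat flow maps a polynomial of degree `i` times the Gaussian weight of variance `s` to such
a product for the variance `t + s`, with the matching leading coefficient. -/
theorem integral_bmKernel_mul_pow {t s : ℝ} (ht : 0 < t) (hs : 0 < s) (i : ℕ) :
    (∀ y : ℝ, Integrable fun u : ℝ =>
      bmKernel t y u * (bmCoeff s i * ((u : ℂ) ^ i * bmWeight s u))) ∧
    ∃ p : ℂ[X], p.natDegree ≤ i ∧ p.coeff i = bmCoeff (t + s) i ∧
      ∀ y : ℝ, ∫ u : ℝ, bmKernel t y u * (bmCoeff s i * ((u : ℂ) ^ i * bmWeight s u)) =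
        bmWeight (t + s) y * p.eval (y : ℂ) := by
  have htc : (t : ℂ) ≠ 0 := by exact_mod_cast ht.ne'
  have hsc : (s : ℂ) ≠ 0 := by exact_mod_cast hs.ne'
  have htsc : (t + s : ℂ) ≠ 0 := by exact_mod_cast (add_pos ht hs).ne'
  set b : ℝ := (t + s) / (2 * t * s) with hb
  have hb0 : 0 < b := by positivity
  have hF : ∀ (y u : ℝ), bmKernel t y u * (bmCoeff s i * ((u : ℂ) ^ i * bmWeight s u)) =
      (1 / (√(2 * π * t) : ℝ) * (1 / (√(2 * π * s) : ℝ)) * Complex.exp (-y ^ 2 / (2 * t)) *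
        bmCoeff s i) * ((u : ℂ) ^ i * Complex.exp (-b * u ^ 2 + (y / t) * u)) := by
    intro y u
    have : Complex.exp (-(u - y) ^ 2 / (2 * t)) * Complex.exp (-u ^ 2 / (2 * s)) =
        Complex.exp (-y ^ 2 / (2 * t)) * Complex.exp (-b * u ^ 2 + (y / t) * u) := by
      rw [← Complex.exp_add, ← Complex.exp_add]
      congr 1
      rw [hb]
      push_cast
      field_simp
      ring
    rw [bmKernel_of_pos ht, bmWeight]
    linear_combination (1 / (√(2 * π * t) : ℝ) * (1 / (√(2 * π * s) : ℝ)) * bmCoeff s i *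
      (u : ℂ) ^ i) * this
  obtain ⟨q, hq1, hq2, hq3⟩ := exists_polynomial_gaussian_moment hb0 i
  refine ⟨fun y => ?_, C (bmCoeff s i) * q.comp (C (1 / (t : ℂ)) * X), ?_, ?_, fun y => ?_⟩
  · simp_rw [hF]
    exact (integrable_pow_mul_cexp_quadratic hb0 i _).const_mul _
  · refine (natDegree_C_mul_le _ _).trans (natDegree_comp_le.trans ?_)
    calc q.natDegree * (C (1 / (t : ℂ)) * X).natDegree ≤ i * 1 :=
          Nat.mul_le_mul hq1 ((natDegree_C_mul_le _ _).trans natDegree_X_le)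
      _ = i := mul_one i
  · rw [coeff_C_mul, comp_C_mul_X_coeff, hq2, bmCoeff, bmCoeff, mul_assoc, ← mul_pow, ← mul_pow]
    congr 2
    rw [hb]
    push_cast
    field_simp
  · simp_rw [hF]
    rw [integral_const_mul, hq3, bmWeight]
    have e1 : ((π : ℂ) / b) ^ (1 / 2 : ℂ) = (√(π / b) : ℝ) := by
      rw [ofReal_sqrt_eq_cpow (by positivity)]
      push_cast
      rfl
    have e2 : (1 / (√(2 * π * t) : ℝ) * (1 / (√(2 * π * s) : ℝ)) * (√(π / b) : ℝ) : ℂ) =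
        1 / (√(2 * π * (t + s)) : ℝ) := by
      have : √(2 * π * t) * √(2 * π * s) = √(π / b) * √(2 * π * (t + s)) := by
        rw [← Real.sqrt_mul (by positivity), ← Real.sqrt_mul (by positivity), hb]
        congr 1
        field_simp
      have h' : ((√(2 * π * t) : ℝ) : ℂ) * (√(2 * π * s) : ℝ) =
        (√(π / b) : ℝ) * (√(2 * π * (t + s)) : ℝ) := by exact_mod_cast this
      have n1 : ((√(2 * π * t) : ℝ) : ℂ) ≠ 0 := by
        exact_mod_cast (Real.sqrt_pos.2 (by positivity)).ne'
      have n2 : ((√(2 * π * s) : ℝ) : ℂ) ≠ 0 := by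
        exact_mod_cast (Real.sqrt_pos.2 (by positivity)).ne'
      have n3 : ((√(2 * π * (t + s)) : ℝ) : ℂ) ≠ 0 := by
        exact_mod_cast (Real.sqrt_pos.2 (by positivity)).ne'
      field_simp
      linear_combination -h'
    have e3 : Complex.exp (-y ^ 2 / (2 * t)) * Complex.exp ((y / t) ^ 2 / (4 * b)) =
        Complex.exp (-y ^ 2 / (2 * ((t + s : ℝ) : ℂ))) := by
      rw [← Complex.exp_add]
      congr 1
      rw [hb]
      push_cast
      field_simp
      ring
    rw [e1, ← e2, ← e3]
    simp only [eval_mul, eval_C, eval_comp, eval_X]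
    have : 1 / (t : ℂ) * y = y / t := by ring
    rw [this]
    ring

/-- The semigroup property behind the theorem: starting from the GUE eigenvalues at time `s` is the
same as starting from `N δ₀`, time `s` earlier. -/
theorem setIntegral_bmHPlus {N : ℕ} {t s : ℝ} (ht : 0 < t) (hs : 0 < s) (y : Fin N → ℝ) :
    IntegrableOn (fun a => bmHPlus t y a * ((vandermondeProd a : ℂ) * bmHPlus s a (fun _ => 0)))
      (weylA N) ∧
    ∫ a in weylA N, bmHPlus t y a * ((vandermondeProd a : ℂ) * bmHPlus s a (fun _ => 0)) =
      bmHPlus (t + s) y (fun _ => 0) := by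
  have hcongr : ∀ a ∈ weylA N,
      Matrix.det (Matrix.of fun j k : Fin N => bmKernel t (y k) (a j)) *
        Matrix.det (Matrix.of fun i j : Fin N =>
          bmCoeff s i * ((a j : ℂ) ^ (i : ℕ) * bmWeight s (a j))) =
      bmHPlus t y a * ((vandermondeProd a : ℂ) * bmHPlus s a (fun _ => 0)) := by
    intro a ha
    rw [← bmHPlus_mul_vandermondeProd t y a (StrictMono.injective ha), bmHPlus_zero_eq_det hs,
      mul_assoc]
  obtain ⟨h1, h2⟩ := integral_weylA_det_mul_det
    (fun (i : Fin N) (u : ℝ) => bmCoeff s i * ((u : ℂ) ^ (i : ℕ) * bmWeight s u))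
    (fun k u => bmKernel t (y k) u) (fun i j => (integral_bmKernel_mul_pow ht hs i).1 (y j))
  refine ⟨h1.congr_fun hcongr (measurableSet_weylA N), ?_⟩
  rw [← setIntegral_congr_fun (measurableSet_weylA N) hcongr, h2, bmHPlus_zero (add_pos ht hs),
    det_eval_of_natDegree_le y]
  intro i
  obtain ⟨p, hp1, hp2, hp3⟩ := (integral_bmKernel_mul_pow ht hs i).2
  exact ⟨p, hp1, hp2, fun k => hp3 (y k)⟩

theorem prod_sq_pow_mul_self {R : Type*} [CommSemiring R] (N : ℕ) (x : R) :
    (∏ j : Fin N, (x ^ 2) ^ (j : ℕ)) * x ^ N = x ^ N ^ 2 := by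
  induction N with
  | zero => simp
  | succ n ih =>
    rw [Fin.prod_univ_castSucc]
    simp only [Fin.val_castSucc, Fin.val_last]
    calc _ = ((∏ j : Fin n, (x ^ 2) ^ (j : ℕ)) * x ^ n) * (x ^ 2) ^ n * x := by ring
      _ = _ := by rw [ih]; ring

/-- The GUE density is the one-time density of the process started from `N δ₀`, at time `σ²`. -/
theorem guePdf_eq {N : ℕ} {σ : ℝ} (hσ : 0 < σ) (a : Fin N → ℝ) :
    (guePdf σ a : ℂ) = (vandermondeProd a : ℂ) * bmHPlus (σ ^ 2) a (fun _ => 0) := by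
  have hs : √(2 * π * σ ^ 2) = √(2 * π) * σ := by
    rw [Real.sqrt_mul (by positivity), Real.sqrt_sq hσ.le]
  have hp : (2 * π) ^ ((N : ℝ) / 2) = √(2 * π) ^ N := by
    rw [Real.sqrt_eq_rpow, ← Real.rpow_natCast, ← Real.rpow_mul (by positivity)]
    ring_nf
  have hw : ∀ u : ℝ, bmWeight (σ ^ 2) u =
      ((1 / (√(2 * π) * σ) * Real.exp (-u ^ 2 / (2 * σ ^ 2)) : ℝ) : ℂ) := by
    intro u
    rw [bmWeight, hs]
    push_cast
    rfl
  have hc : ∀ j : Fin N, bmCoeff (σ ^ 2) j =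
      ((1 / Real.Gamma ((j : ℝ) + 1) * (1 / (σ ^ 2) ^ (j : ℕ)) : ℝ) : ℂ) := by
    intro j
    rw [bmCoeff, Real.Gamma_nat_eq_factorial]
    push_cast
    rw [one_div_pow]
  rw [bmHPlus_zero (by positivity)]
  simp_rw [hw, hc]
  rw [← Complex.ofReal_prod, ← Complex.ofReal_prod]
  norm_cast
  rw [guePdf, hp, Finset.prod_mul_distrib, Finset.prod_mul_distrib, ← Real.exp_sum,
    ← prod_sq_pow_mul_self]
  simp only [one_div, Finset.prod_inv_distrib, Finset.prod_const, Finset.card_univ,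
    Fintype.card_fin, mul_pow]
  have : ∑ k, -a k ^ 2 / (2 * σ ^ 2) = -(∑ j, a j ^ 2) / (2 * σ ^ 2) := by
    rw [← Finset.sum_div, Finset.sum_neg_distrib]
  rw [this]
  push_cast
  field_simp

/-! ### Laplace transforms of Bessel series -/

/-- The coefficients of the entire function `∑ wᵐ / (m! Γ(m + 1 + ν))`, which is
`(z / 2)^(-ν) I_ν(z)` at `w = (z / 2)²`. -/
noncomputable def besselCoeff (ν : ℝ) (m : ℕ) : ℂ :=
  1 / ((Real.Gamma (m + 1) * Real.Gamma (m + 1 + ν) : ℝ) : ℂ)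

open Polynomial in
/-- Kummer's transformation for `₁F₁(ν + 1 + k; ν + 1; ζ)`, up to a constant: it is the exponential
of `ζ` times a Laguerre polynomial. The induction on `k` uses `m + 1 + ν = (ν + 1) + m`, whose two
summands lead to the series with `ν` raised by one and by two. -/
theorem exists_polynomial_hasSum_besselCoeff (k : ℕ) : ∀ {ν : ℝ}, -1 < ν →
    ∃ q : ℂ[X], q.natDegree ≤ k ∧ q.coeff k = 1 ∧ ∀ ζ : ℂ,
      HasSum (fun m : ℕ => besselCoeff ν m * (Real.Gamma (ν + k + m + 1) : ℝ) * ζ ^ m)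
        (Complex.exp ζ * q.eval ζ) := by
  induction k with
  | zero =>
    intro ν hν
    refine ⟨1, by simp, by simp, fun ζ => ?_⟩
    have h : HasSum (fun m : ℕ => ζ ^ m / (m.factorial : ℂ)) (Complex.exp ζ) := by
      rw [Complex.exp_eq_exp_ℂ]
      exact NormedSpace.expSeries_div_hasSum_exp ζ
    rw [eval_one, mul_one]
    refine h.congr_fun fun m => ?_
    have hm : (0 : ℝ) < ν + m + 1 := by
      have : (0 : ℝ) ≤ m := Nat.cast_nonneg m
      linarith
    have hG : ((Real.Gamma (ν + m + 1) : ℝ) : ℂ) ≠ 0 := by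
      exact_mod_cast (Real.Gamma_pos_of_pos hm).ne'
    have e : (m : ℝ) + 1 + ν = ν + m + 1 := by ring
    rw [besselCoeff, Real.Gamma_nat_eq_factorial, e]
    push_cast
    rw [add_zero]
    field_simp
  | succ k ih =>
    intro ν hν
    obtain ⟨q1, h11, h12, h13⟩ := ih (ν := ν + 1) (by linarith)
    obtain ⟨q2, h21, h22, h23⟩ := ih (ν := ν + 2) (by linarith)
    refine ⟨C ((ν : ℂ) + 1) * q1 + X * q2, ?_, ?_, fun ζ => ?_⟩
    · refine natDegree_add_le_of_degree_le ((natDegree_C_mul_le _ _).trans (by omega)) ?_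
      exact natDegree_mul_le.trans (by rw [natDegree_X]; omega)
    · rw [coeff_add, coeff_C_mul, coeff_X_mul, h22,
        coeff_eq_zero_of_natDegree_lt (p := q1) (by omega), mul_zero, zero_add]
    · have s2 : HasSum (fun m : ℕ => (m : ℂ) * (besselCoeff (ν + 1) m *
          (Real.Gamma (ν + 1 + k + m + 1) : ℝ) * ζ ^ m)) (ζ * (Complex.exp ζ * q2.eval ζ)) := by
        rw [← hasSum_nat_add_iff' 1]
        simp only [Finset.range_one, Finset.sum_singleton, Nat.cast_zero, zero_mul, sub_zero]
        refine ((h23 ζ).mul_left ζ).congr_fun fun m => ?_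
        have e1 : ν + 1 + k + ((m + 1 : ℕ) : ℝ) + 1 = ν + 2 + k + m + 1 := by push_cast; ring
        have e2 : ((m + 1 : ℕ) : ℝ) + 1 + (ν + 1) = m + 1 + (ν + 2) := by push_cast; ring
        have hm : ((m : ℂ) + 1) ≠ 0 := by exact_mod_cast Nat.succ_ne_zero m
        rw [besselCoeff, besselCoeff, Real.Gamma_nat_eq_factorial, Real.Gamma_nat_eq_factorial,
          e1, e2, Nat.factorial_succ]
        push_cast
        have hf : ((m.factorial : ℕ) : ℂ) ≠ 0 := by exact_mod_cast m.factorial_ne_zero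
        have hm2 : (0 : ℝ) < m + 1 + (ν + 2) := by
          have : (0 : ℝ) ≤ m := Nat.cast_nonneg m
          linarith
        have hG : ((Real.Gamma (m + 1 + (ν + 2)) : ℝ) : ℂ) ≠ 0 := by
          exact_mod_cast (Real.Gamma_pos_of_pos hm2).ne'
        field_simp
        ring
      have s1 := (h13 ζ).mul_left ((ν : ℂ) + 1)
      have := s1.add s2
      have hval : Complex.exp ζ * (C ((ν : ℂ) + 1) * q1 + X * q2).eval ζ =
          ((ν : ℂ) + 1) * (Complex.exp ζ * q1.eval ζ) + ζ * (Complex.exp ζ * q2.eval ζ) := by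
        simp only [eval_add, eval_mul, eval_C, eval_X]
        ring
      rw [hval]
      refine this.congr_fun fun m => ?_
      have hm : (0 : ℝ) < m + 1 + ν := by
        have : (0 : ℝ) ≤ m := Nat.cast_nonneg m
        linarith
      have hG : ((Real.Gamma (m + 1 + ν) : ℝ) : ℂ) ≠ 0 := by
        exact_mod_cast (Real.Gamma_pos_of_pos hm).ne'
      have hmc : ((m + 1 + ν : ℝ) : ℂ) ≠ 0 := by exact_mod_cast hm.ne'
      have hf : ((m.factorial : ℕ) : ℂ) ≠ 0 := by exact_mod_cast m.factorial_ne_zero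
      have e1 : (m : ℝ) + 1 + (ν + 1) = (m + 1 + ν) + 1 := by ring
      have e2 : ν + ((k + 1 : ℕ) : ℝ) + m + 1 = ν + 1 + k + m + 1 := by push_cast; ring
      rw [besselCoeff, besselCoeff, Real.Gamma_nat_eq_factorial, e1, e2,
        Real.Gamma_add_one hm.ne']
      push_cast at hmc ⊢
      field_simp
      ring

/-- For `ν > -1` the numbers `Γ(m + 1 + ν)` are bounded below by a positive constant, so that the
coefficients are dominated by those of the exponential series. -/
theorem summable_besselCoeff {ν : ℝ} (hν : -1 < ν) (r : ℝ) (hr : 0 ≤ r) :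
    Summable fun m : ℕ => ‖besselCoeff ν m‖ * r ^ m := by
  obtain ⟨c, hc, hle⟩ : ∃ c : ℝ, 0 < c ∧ ∀ m : ℕ, c ≤ Real.Gamma (m + 1 + ν) := by
    have g1 : 0 < Real.Gamma (1 + ν) := Real.Gamma_pos_of_pos (by linarith)
    have g2 : 0 < Real.Gamma (2 + ν) := Real.Gamma_pos_of_pos (by linarith)
    have h : ∀ m : ℕ, Real.Gamma (2 + ν) ≤ Real.Gamma ((m + 1 : ℕ) + 1 + ν) := by
      intro m
      induction m with
      | zero =>
        refine le_of_eq ?_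
        congr 1
        push_cast
        ring
      | succ m ih =>
        have hm : (1 : ℝ) ≤ (m + 1 : ℕ) + 1 + ν := by
          have : (0 : ℝ) ≤ m := Nat.cast_nonneg m
          push_cast
          linarith
        have e : ((m + 1 + 1 : ℕ) : ℝ) + 1 + ν = ((m + 1 : ℕ) + 1 + ν) + 1 := by push_cast; ring
        rw [e, Real.Gamma_add_one (by linarith)]
        nlinarith
    refine ⟨min (Real.Gamma (1 + ν)) (Real.Gamma (2 + ν)), lt_min g1 g2, fun m => ?_⟩
    rcases m with _ | m
    · refine (min_le_left _ _).trans (le_of_eq ?_)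
      congr 1
      push_cast
      ring
    · exact (min_le_right _ _).trans (h m)
  refine Summable.of_nonneg_of_le (fun m => by positivity) (fun m => ?_)
    ((Real.summable_pow_div_factorial r).mul_left c⁻¹)
  have hG : 0 < Real.Gamma (m + 1 + ν) := hc.trans_le (hle m)
  rw [besselCoeff, Real.Gamma_nat_eq_factorial, norm_div, norm_one, Complex.norm_real,
    Real.norm_of_nonneg (by positivity), one_div, mul_inv]
  have : (Real.Gamma (m + 1 + ν))⁻¹ ≤ c⁻¹ := inv_anti₀ hc (hle m)
  calc (m.factorial : ℝ)⁻¹ * (Real.Gamma (m + 1 + ν))⁻¹ * r ^ m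
      ≤ (m.factorial : ℝ)⁻¹ * c⁻¹ * r ^ m := by gcongr
    _ = _ := by ring

theorem integral_rpow_mul_exp_neg_mul {α ρ : ℝ} (hα : -1 < α) (hρ : 0 < ρ) :
    IntegrableOn (fun u : ℝ => u ^ α * Real.exp (-(ρ * u))) (Set.Ioi 0) ∧
    ∫ u in Set.Ioi (0 : ℝ), u ^ α * Real.exp (-(ρ * u)) =
      (1 / ρ) ^ (α + 1) * Real.Gamma (α + 1) := by
  have h := Real.integral_rpow_mul_exp_neg_mul_Ioi (a := α + 1) (by linarith) hρ
  rw [add_sub_cancel_right] at h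
  refine ⟨Integrable.of_integral_ne_zero ?_, h⟩
  rw [h]
  have := Real.Gamma_pos_of_pos (show 0 < α + 1 by linarith)
  positivity

open Polynomial in
/-- Laplace transform of a Bessel series against `u^(ν + k)`, integrated term by term. -/
theorem exists_polynomial_bessel_moment {ν : ℝ} (hν : -1 < ν) (k : ℕ) :
    ∃ q : ℂ[X], q.natDegree ≤ k ∧ q.coeff k = 1 ∧ ∀ (ρ : ℝ), 0 < ρ → ∀ z : ℂ,
      IntegrableOn (fun u : ℝ => ((u ^ (ν + k) * Real.exp (-(ρ * u)) : ℝ) : ℂ) *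
        ∑' m : ℕ, besselCoeff ν m * (z * u) ^ m) (Set.Ioi 0) ∧
      ∫ u in Set.Ioi (0 : ℝ), ((u ^ (ν + k) * Real.exp (-(ρ * u)) : ℝ) : ℂ) *
        ∑' m : ℕ, besselCoeff ν m * (z * u) ^ m =
        (((1 / ρ) ^ (ν + k + 1) : ℝ) : ℂ) * (Complex.exp (z / ρ) * q.eval (z / ρ)) := by
  obtain ⟨q, hq1, hq2, hq3⟩ := exists_polynomial_hasSum_besselCoeff k hν
  refine ⟨q, hq1, hq2, fun ρ hρ z => ?_⟩
  have hk : (0 : ℝ) ≤ k := Nat.cast_nonneg k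
  have hρc : (ρ : ℂ) ≠ 0 := by exact_mod_cast hρ.ne'
  set F : ℕ → ℝ → ℂ := fun m u => (besselCoeff ν m * z ^ m) *
    ((u ^ (ν + k + m) * Real.exp (-(ρ * u)) : ℝ) : ℂ) with hF
  have hα : ∀ m : ℕ, -1 < ν + k + m := fun m => by
    have : (0 : ℝ) ≤ m := Nat.cast_nonneg m
    linarith
  have hFint : ∀ m, IntegrableOn (F m) (Set.Ioi 0) := fun m =>
    ((integral_rpow_mul_exp_neg_mul (hα m) hρ).1.ofReal).const_mul _
  have hpow : ∀ m : ℕ, (1 / ρ) ^ (ν + k + m + 1) = (1 / ρ) ^ (ν + k + 1) * (1 / ρ) ^ m := by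
    intro m
    rw [← Real.rpow_natCast, ← Real.rpow_add (by positivity)]
    ring_nf
  have hFval : ∀ m, ∫ u in Set.Ioi (0 : ℝ), F m u = (((1 / ρ) ^ (ν + k + 1) : ℝ) : ℂ) *
      (besselCoeff ν m * (Real.Gamma (ν + k + m + 1) : ℝ) * (z / ρ) ^ m) := by
    intro m
    simp only [hF]
    rw [integral_const_mul, integral_complex_ofReal, (integral_rpow_mul_exp_neg_mul (hα m) hρ).2,
      hpow]
    push_cast
    rw [div_pow, div_pow, one_pow]
    ring
  have hFnorm : ∀ m, ∫ u in Set.Ioi (0 : ℝ), ‖F m u‖ = (1 / ρ) ^ (ν + k + 1) *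
      ‖besselCoeff ν m * (Real.Gamma (ν + k + m + 1) : ℝ) * (z / ρ) ^ m‖ := by
    intro m
    have hpt : ∀ u ∈ Set.Ioi (0 : ℝ), ‖F m u‖ = ‖besselCoeff ν m * z ^ m‖ *
        (u ^ (ν + k + m) * Real.exp (-(ρ * u))) := by
      intro u hu
      have hu' : 0 < u := hu
      simp only [hF]
      rw [norm_mul, Complex.norm_real, Real.norm_of_nonneg (by positivity)]
    have hG := Real.Gamma_pos_of_pos (show 0 < ν + k + m + 1 by linarith [hα m])
    rw [setIntegral_congr_fun measurableSet_Ioi hpt, integral_const_mul,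
      (integral_rpow_mul_exp_neg_mul (hα m) hρ).2, hpow, norm_mul, norm_mul, norm_mul,
      Complex.norm_real, Real.norm_of_nonneg hG.le, norm_pow, norm_pow, norm_div,
      Complex.norm_real, Real.norm_of_nonneg hρ.le, div_pow, div_pow, one_pow]
    ring
  have hsum : Summable fun m => ∫ u in Set.Ioi (0 : ℝ), ‖F m u‖ := by
    simp_rw [hFnorm]
    exact (hq3 (z / ρ)).summable.norm.mul_left _
  have hpt : ∀ u ∈ Set.Ioi (0 : ℝ), ∑' m, F m u =
      ((u ^ (ν + k) * Real.exp (-(ρ * u)) : ℝ) : ℂ) *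
        ∑' m : ℕ, besselCoeff ν m * (z * u) ^ m := by
    intro u hu
    have hu' : 0 < u := hu
    rw [← tsum_mul_left]
    refine tsum_congr fun m => ?_
    simp only [hF]
    rw [Real.rpow_add_natCast hu'.ne', mul_pow]
    push_cast
    ring
  constructor
  · refine IntegrableOn.congr_fun (f := fun u => ∑' m, F m u) ?_ hpt measurableSet_Ioi
    have hmeas : AEStronglyMeasurable (fun u => ∑' m, F m u) (volume.restrict (Set.Ioi 0)) := by
      have hB : Continuous fun w : ℂ => ∑' m : ℕ, besselCoeff ν m * w ^ m :=
        (differentiable_tsum_mul_pow _ (summable_besselCoeff hν)).continuous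
      have : Measurable fun u : ℝ => ((u ^ (ν + k) * Real.exp (-(ρ * u)) : ℝ) : ℂ) *
          ∑' m : ℕ, besselCoeff ν m * (z * u) ^ m := by
        refine Measurable.mul (by fun_prop) ?_
        exact (hB.comp (by fun_prop : Continuous fun u : ℝ => z * (u : ℂ))).measurable
      refine this.aestronglyMeasurable.congr ?_
      filter_upwards [ae_restrict_mem measurableSet_Ioi] with u hu
      exact (hpt u hu).symm
    refine ⟨hmeas, ?_⟩
    rw [hasFiniteIntegral_iff_enorm]
    refine (lintegral_mono fun u => enorm_tsum_le_tsum_enorm).trans_lt ?_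
    rw [lintegral_tsum fun m => (hFint m).aestronglyMeasurable.enorm]
    have he : ∀ m, ∫⁻ u in Set.Ioi (0 : ℝ), ‖F m u‖ₑ =
        ENNReal.ofReal (∫ u in Set.Ioi (0 : ℝ), ‖F m u‖) := fun m =>
      (ofReal_integral_norm_eq_lintegral_enorm (hFint m)).symm
    simp_rw [he]
    rw [← ENNReal.ofReal_tsum_of_nonneg (fun m => integral_nonneg fun u => norm_nonneg _) hsum]
    exact ENNReal.ofReal_lt_top
  · rw [← setIntegral_congr_fun measurableSet_Ioi hpt]
    refine (hasSum_integral_of_summable_integral_norm hFint hsum).unique ?_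
    simp_rw [hFval]
    exact (hq3 (z / ρ)).mul_left _

/-! ### The squared Bessel kernel and `h_N^{(ν,-)}` -/

theorem cexp_cpow {P : ℂ} (h1 : -π < P.im) (h2 : P.im ≤ π) (w : ℂ) :
    Complex.exp P ^ w = Complex.exp (P * w) := by
  rw [Complex.cpow_def_of_ne_zero (Complex.exp_ne_zero _), Complex.log_exp h1 h2]

/-- The kernel in logarithmic coordinates `y = e^P`, `x = e^Q`, `2t = e^T`, as long as all principal
arguments stay in the principal strip: the fractional powers of `x` cancel, and the series is in
integral powers. -/
theorem besqKernel_cexp (ν t : ℝ) {P Q T : ℂ} (hT : Complex.exp T = 2 * t)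
    (h1 : -π < (P - Q).im) (h1' : (P - Q).im ≤ π) (h2 : -π < (Q + P).im) (h2' : (Q + P).im ≤ π)
    (h3 : -π < ((Q + P) / 2 - T).im) (h3' : ((Q + P) / 2 - T).im ≤ π) :
    besqKernel ν t (Complex.exp P) (Complex.exp Q) =
      1 / ((2 * |t| : ℝ) : ℂ) * Complex.exp (ν * (P - T)) *
        Complex.exp (-(Complex.exp Q + Complex.exp P) / (2 * t)) *
        ∑' m : ℕ, besselCoeff ν m *
          (1 / (4 * t ^ 2) * (Complex.exp P * Complex.exp Q)) ^ m := by
  have hz : (Complex.exp Q * Complex.exp P) ^ (1 / 2 : ℂ) / t / 2 =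
      Complex.exp ((Q + P) / 2 - T) := by
    rw [← Complex.exp_add, cexp_cpow h2 h2', Complex.exp_sub, hT, div_div, mul_comm (t : ℂ)]
    congr 2
    ring
  have hw : 1 / (4 * t ^ 2) * (Complex.exp P * Complex.exp Q) = Complex.exp (Q + P - 2 * T) := by
    rw [Complex.exp_sub, two_mul T, Complex.exp_add T, hT, Complex.exp_add]
    ring
  rw [besqKernel, if_neg (Complex.exp_ne_zero _), besselI, ← Complex.exp_sub, cexp_cpow h1 h1', hw,
    hz, ← tsum_mul_left, ← tsum_mul_left]
  refine tsum_congr fun m => ?_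
  have he : Complex.exp ((P - Q) * (ν / 2)) * Complex.exp (((Q + P) / 2 - T) * (2 * m + ν)) =
      Complex.exp (ν * (P - T)) * Complex.exp (Q + P - 2 * T) ^ m := by
    rw [← Complex.exp_nat_mul, ← Complex.exp_add, ← Complex.exp_add]
    congr 1
    ring
  rw [cexp_cpow h3 h3', besselCoeff]
  linear_combination (1 / ((2 * |t| : ℝ) : ℂ) *
    Complex.exp (-(Complex.exp Q + Complex.exp P) / (2 * t)) *
    (1 / ((Real.Gamma (m + 1) * Real.Gamma (m + 1 + ν) : ℝ) : ℂ))) * he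

/-- The kernel `p^{(ν)}(t, y|0)` without its factor `1 / Γ(ν + 1)`, for `t > 0` and `y ≥ 0`. -/
noncomputable def besqWeight (ν t y : ℝ) : ℂ :=
  ((y ^ ν / (2 * t) ^ (ν + 1) : ℝ) : ℂ) * Complex.exp (-y / (2 * t))

/-- The entire function of `s` which the kernel `p^{(ν)}(t, y|s)` coincides with off the negative
half-line, for `t > 0` and `y ≥ 0`. -/
noncomputable def besqKernelExt (ν t y : ℝ) (s : ℂ) : ℂ :=
  besqWeight ν t y * (Complex.exp (-s / (2 * t)) *
    ∑' m : ℕ, besselCoeff ν m * (1 / (4 * t ^ 2) * (y * s)) ^ m)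

theorem tsum_besselCoeff_zero (ν : ℝ) :
    ∑' m : ℕ, besselCoeff ν m * (0 : ℂ) ^ m = 1 / (Real.Gamma (ν + 1) : ℝ) := by
  rw [tsum_eq_single 0]
  · simp [besselCoeff, add_comm]
  · intro m hm
    simp [hm]

theorem besqKernel_eq_ext {ν t y : ℝ} (hν : -1 < ν) (ht : 0 < t) (hy : 0 ≤ y) {s : ℂ}
    (hs : s.arg ≠ π) : besqKernel ν t y s = besqKernelExt ν t y s := by
  have hν1 : ν + 1 ≠ 0 := by linarith
  rw [besqKernelExt, besqWeight]
  by_cases hs0 : s = 0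
  · subst hs0
    rw [besqKernel, if_pos rfl, mul_zero, mul_zero, tsum_besselCoeff_zero, abs_of_pos ht,
      ← Complex.ofReal_cpow hy]
    push_cast
    simp
    ring
  rcases hy.eq_or_lt with rfl | hy
  · -- At `y = 0` both sides vanish unless `ν = 0`, by the convention for powers of `0`.
    rw [Complex.ofReal_zero, zero_mul, mul_zero, tsum_besselCoeff_zero]
    rw [besqKernel, if_neg hs0]
    by_cases hν0 : ν = 0
    · subst hν0
      have hI : besselI 0 ((s * 0) ^ (1 / 2 : ℂ) / t) = 1 := by
        rw [besselI, tsum_eq_single 0]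
        · simp
        · intro m hm
          simp [hm]
      rw [hI, abs_of_pos ht]
      simp
    · have : (ν / 2 : ℂ) ≠ 0 := by simpa using hν0
      rw [zero_div, Complex.zero_cpow this, Real.zero_rpow hν0]
      simp
  · have hlog : ∀ x : ℝ, 0 < x → (x : ℂ) = Complex.exp (Real.log x) := by
      intro x hx
      rw [← Complex.ofReal_exp, Real.exp_log hx]
    have harg := Complex.arg_le_pi s
    have harg' := Complex.neg_pi_lt_arg s
    have hlt : s.arg < π := lt_of_le_of_ne harg hs
    have h := besqKernel_cexp ν t (P := Real.log y) (Q := Complex.log s) (T := Real.log (2 * t))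
      (by rw [← hlog _ (by positivity)]; push_cast; ring)
      (by simpa [Complex.log_im] using hlt) (by simp [Complex.log_im]; linarith)
      (by simpa [Complex.log_im] using harg') (by simpa [Complex.log_im] using harg)
      (by simp [Complex.log_im]; linarith) (by simp [Complex.log_im]; linarith [Real.pi_pos])
    rw [← hlog y hy, Complex.exp_log hs0] at h
    have hpow : 1 / ((2 * |t| : ℝ) : ℂ) * Complex.exp (ν * (Real.log y - Real.log (2 * t))) =
        ((y ^ ν / (2 * t) ^ (ν + 1) : ℝ) : ℂ) := by
      rw [abs_of_pos ht, Real.rpow_add (by positivity), Real.rpow_one,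
        Real.rpow_def_of_pos hy, Real.rpow_def_of_pos (by positivity : 0 < 2 * t), mul_sub,
        Complex.exp_sub]
      push_cast
      rw [mul_comm (ν : ℂ), mul_comm (ν : ℂ)]
      field_simp
    rw [h, hpow]
    have he : Complex.exp (-(s + y) / (2 * t)) =
        Complex.exp (-y / (2 * t)) * Complex.exp (-s / (2 * t)) := by
      rw [← Complex.exp_add]
      congr 1
      ring
    rw [he]
    ring

/-- The phase by which `p^{(ν)}(-t, s|x)`, for `s < 0`, differs from a positive kernel times a power
series. With principal powers the formula for `x = 0` involves `s^ν`, hence a factor `e^{iπν}`,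
whereas for `x > 0` the phases of the two fractional powers cancel. -/
noncomputable def besqPhase (ν x : ℝ) : ℂ := if x = 0 then Complex.exp (π * Complex.I * ν) else 1

theorem besqKernel_neg {ν t x u : ℝ} (hν : -1 < ν) (ht : 0 < t) (hx : 0 ≤ x) (hu : 0 < u) :
    besqKernel ν (-t) (-u : ℝ) x = besqPhase ν x * (((u ^ ν / (2 * t) ^ (ν + 1) *
      Real.exp (-(1 / (2 * t) * u)) : ℝ) : ℂ) * Complex.exp (x / (2 * t)) *
        ∑' m : ℕ, besselCoeff ν m * (-x / (4 * t ^ 2) * u) ^ m) := by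
  have hν1 : ν + 1 ≠ 0 := by linarith
  have htc : (t : ℂ) ≠ 0 := by exact_mod_cast ht.ne'
  rcases hx.eq_or_lt with rfl | hx
  · have hpow : ((-u : ℝ) : ℂ) ^ (ν : ℂ) = ((u ^ ν : ℝ) : ℂ) * Complex.exp (π * Complex.I * ν) := by
      rw [Complex.ofReal_cpow_of_nonpos (by linarith), Complex.ofReal_cpow hu.le]
      simp
    have h0 : (∑' m : ℕ, besselCoeff ν m * (-((0 : ℝ) : ℂ) / (4 * t ^ 2) * u) ^ m : ℂ) =
        1 / (Real.Gamma (ν + 1) : ℝ) := by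
      rw [← tsum_besselCoeff_zero]
      simp
    have he : Complex.exp (-((-u : ℝ) : ℂ) / (2 * ((-t : ℝ) : ℂ))) =
        (Real.exp (-(1 / (2 * t) * u)) : ℝ) := by
      push_cast
      congr 1
      field_simp
    rw [besqKernel, if_pos (by simp), besqPhase, if_pos rfl, hpow, h0, he, abs_neg, abs_of_pos ht]
    push_cast
    simp
    field_simp
  · have hlog : ∀ x : ℝ, 0 < x → (x : ℂ) = Complex.exp (Real.log x) := by
      intro x hx
      rw [← Complex.ofReal_exp, Real.exp_log hx]
    have hexp : ∀ x : ℝ, 0 < x → Complex.exp (Real.log x + π * Complex.I) = -x := by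
      intro x hx
      rw [Complex.exp_add, ← hlog x hx, Complex.exp_pi_mul_I]
      ring
    have hpi := Real.pi_pos
    -- Taking `π i` in the logarithms of both `-u` and `-2t` makes the imaginary parts cancel.
    have h := besqKernel_cexp ν (-t) (P := Real.log u + π * Complex.I) (Q := Real.log x)
      (T := Real.log (2 * t) + π * Complex.I)
      (by rw [hexp _ (by positivity)]; push_cast; ring)
      (by simp; linarith) (by simp) (by simp; linarith) (by simp)
      (by simp; linarith) (by simp; linarith)
    rw [hexp u hu, ← hlog x hx] at h
    have hpow : 1 / ((2 * |-t| : ℝ) : ℂ) * Complex.exp (ν * (Real.log u + π * Complex.I -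
        (Real.log (2 * t) + π * Complex.I))) = ((u ^ ν / (2 * t) ^ (ν + 1) : ℝ) : ℂ) := by
      rw [abs_neg, abs_of_pos ht, Real.rpow_add (by positivity), Real.rpow_one,
        Real.rpow_def_of_pos hu, Real.rpow_def_of_pos (by positivity : 0 < 2 * t),
        add_sub_add_right_eq_sub, mul_sub, Complex.exp_sub]
      push_cast
      rw [mul_comm (ν : ℂ), mul_comm (ν : ℂ)]
      field_simp
    have he : Complex.exp (-((x : ℂ) + -u) / (2 * ((-t : ℝ) : ℂ))) =
        (Real.exp (-(1 / (2 * t) * u)) : ℝ) * Complex.exp (x / (2 * t)) := by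
      push_cast
      rw [← Complex.exp_add]
      congr 1
      field_simp
      ring
    have hm : 1 / (4 * ((-t : ℝ) : ℂ) ^ 2) * (-(u : ℂ) * x) = -x / (4 * t ^ 2) * u := by
      push_cast
      ring
    rw [hpow, he, hm] at h
    rw [besqPhase, if_neg hx.ne', Complex.ofReal_neg, h]
    push_cast
    ring

open Polynomial in
/-- Up to the phase at `x = 0`, the inverse squared Bessel flow maps a monic polynomial to a monic
polynomial of the same degree. -/
theorem besqPhiMinus_eq {N : ℕ} {ν : ℝ} (hν : -1 < ν) (a : Fin N → ℝ) {n : ℕ} (hn : n ≤ N)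
    {t : ℝ} (ht : 0 < t) :
    ∃ p : ℂ[X], p.natDegree ≤ n ∧ p.coeff n = 1 ∧
      ∀ x : ℝ, 0 ≤ x → besqPhiMinus ν a n t x = besqPhase ν x * p.eval (x : ℂ) := by
  have htc : (t : ℂ) ≠ 0 := by exact_mod_cast ht.ne'
  choose q hq1 hq2 hq3 using fun k => exists_polynomial_bessel_moment hν k
  obtain ⟨p, hp1, hp2, hp3⟩ := exists_polynomial_integral_mul_pointProd a hn
    (volume.restrict (Set.Iic 0)) (fun s => (s : ℂ))
    (fun k => C ((-(2 * t : ℂ)) ^ k) * (q k).comp (C (-1 / (2 * t : ℂ)) * X))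
    (fun k => (natDegree_C_mul_le _ _).trans (natDegree_comp_le.trans (by
      calc (q k).natDegree * (C (-1 / (2 * t : ℂ)) * X).natDegree ≤ k * 1 :=
            Nat.mul_le_mul (hq1 k) ((natDegree_C_mul_le _ _).trans natDegree_X_le)
        _ = k := mul_one k)))
    (fun k => by
      rw [coeff_C_mul, comp_C_mul_X_coeff, hq2, one_mul, ← mul_pow]
      have : -(2 * t : ℂ) * (-1 / (2 * t)) = 1 := by
        field_simp
      rw [this, one_pow])
  refine ⟨p, hp1, hp2, fun x hx => ?_⟩
  set G : ℕ → ℝ → ℂ := fun k u =>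
    (besqPhase ν x * (-1) ^ k * ((1 / (2 * t) ^ (ν + 1) : ℝ) : ℂ) * Complex.exp (x / (2 * t))) *
    (((u ^ (ν + k) * Real.exp (-(1 / (2 * t) * u)) : ℝ) : ℂ) *
        ∑' m : ℕ, besselCoeff ν m * (-x / (4 * t ^ 2) * u) ^ m) with hG
  have hρ : 0 < 1 / (2 * t) := by positivity
  have hF : ∀ (k : ℕ), ∀ u ∈ Set.Ioi (0 : ℝ),
      besqKernel ν (-t) ((-u : ℝ) : ℂ) x * ((-u : ℝ) : ℂ) ^ k = G k u := by
    intro k u hu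
    have hu' : 0 < u := hu
    simp only [hG]
    rw [besqKernel_neg hν ht hx hu', Real.rpow_add_natCast hu'.ne']
    push_cast
    rw [neg_pow]
    ring
  have hGint : ∀ k, IntegrableOn (G k) (Set.Ioi 0) := fun k => ((hq3 k _ hρ _).1).const_mul _
  have h := hp3 (fun s => besqKernel ν (-t) s x) (besqPhase ν x) x ?_ ?_
  · rw [besqPhiMinus, h]
  · intro k
    change IntegrableOn (fun s : ℝ => besqKernel ν (-t) s x * (s : ℂ) ^ k) (Set.Iic 0)
    rw [integrableOn_Iic_iff_integrableOn_Iio]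
    have h1 : IntegrableOn (fun s : ℝ => G k (-s)) (Set.Iio 0) := by
      have h2 : IntegrableOn (G k) (Set.Ioi (-0)) := by rw [neg_zero]; exact hGint k
      exact h2.comp_neg_Iio
    refine h1.congr_fun (fun s hs => ?_) measurableSet_Iio
    have hs' : -s ∈ Set.Ioi (0 : ℝ) := by simpa using hs
    have := (hF k (-s) hs').symm
    rwa [neg_neg] at this
  · intro k
    have h1 := integral_comp_neg_Ioi (0 : ℝ) (fun s : ℝ => besqKernel ν (-t) s x * (s : ℂ) ^ k)
    rw [neg_zero] at h1
    rw [← h1, setIntegral_congr_fun measurableSet_Ioi (hF k)]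
    simp only [hG]
    rw [integral_const_mul, (hq3 k _ hρ _).2]
    have e1 : (1 / (1 / (2 * t))) ^ (ν + k + 1) = (2 * t) ^ (ν + 1) * (2 * t) ^ k := by
      rw [one_div_one_div, ← Real.rpow_natCast, ← Real.rpow_add (by positivity)]
      ring_nf
    have e2 : (-(x : ℂ) / (4 * t ^ 2)) / ((1 / (2 * t) : ℝ) : ℂ) = -x / (2 * t) := by
      push_cast
      field_simp
      ring
    have e3 : Complex.exp (x / (2 * t)) * Complex.exp (-x / (2 * t)) = 1 := by
      rw [← Complex.exp_add, neg_div, add_neg_cancel, Complex.exp_zero]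
    have e4 : ((1 / (2 * t) ^ (ν + 1) : ℝ) : ℂ) * (((2 * t) ^ (ν + 1) : ℝ) : ℂ) = 1 := by
      rw [← Complex.ofReal_mul, one_div_mul_cancel (by positivity), Complex.ofReal_one]
    rw [e1, e2]
    simp only [eval_mul, eval_C, eval_comp, eval_X]
    have e5 : -1 / (2 * t : ℂ) * x = -x / (2 * t) := by ring
    rw [e5, neg_pow (2 * t : ℂ)]
    generalize eval (-(x : ℂ) / (2 * t)) (q k) = V
    rw [Complex.ofReal_mul]
    push_cast at e4 ⊢
    linear_combination (besqPhase ν x * (-1) ^ k * (2 * t) ^ k * V) *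
      (1 / (((2 * t) ^ (ν + 1) : ℝ) : ℂ) * (((2 * t) ^ (ν + 1) : ℝ) : ℂ)) * e3 +
      (besqPhase ν x * (-1) ^ k * (2 * t) ^ k * V) * e4

/-- As for Brownian motion, `h_N^{(ν,-)}` depends neither on the time nor on the initial
configuration; the product of phases differs from `1` only on a null set. -/
theorem besqHMinus_eq {N : ℕ} {ν t : ℝ} (hν : -1 < ν) (ht : 0 < t) (y a : Fin N → ℝ)
    (hy : ∀ k, 0 ≤ y k) :
    besqHMinus ν t y a = (∏ k, besqPhase ν (y k)) * (vandermondeProd y : ℂ) := by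
  rw [besqHMinus, det_eval_of_natDegree_le y (fun k => besqPhase ν (y k)) 1]
  · simp
  · intro j
    obtain ⟨p, h1, h2, h3⟩ := besqPhiMinus_eq hν a j.2.le ht
    exact ⟨p, h1, by simpa using h2, fun k => h3 _ (hy k)⟩

/-! ### The function `h_N^{(ν,+)}` and its semigroup property -/

/-- A circle about `0` meets the branch cut of the principal powers in a single point. -/
theorem circleIntegral_congr_of_arg_ne_pi {f g : ℂ → ℂ} {R : ℝ} (hR : 0 < R)
    (h : ∀ s, s.arg ≠ π → f s = g s) : (∮ s in C(0, R), f s) = ∮ s in C(0, R), g s := by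
  rw [circleIntegral, circleIntegral]
  refine intervalIntegral.integral_congr_ae ?_
  have hc : (Set.range fun n : ℤ => (n : ℝ) * π).Countable := Set.countable_range _
  filter_upwards [measure_eq_zero_iff_ae_notMem.1 (hc.measure_zero volume)] with θ hθ _
  rw [h]
  intro harg
  refine hθ ?_
  have him := (Complex.arg_eq_pi_iff.1 harg).2
  rw [circleMap_zero, Complex.im_ofReal_mul, Complex.exp_ofReal_mul_I_im] at him
  exact Real.sin_eq_zero_iff.1 ((mul_eq_zero.1 him).resolve_left hR.ne')

theorem differentiable_besqKernelExt {ν : ℝ} (hν : -1 < ν) (t y : ℝ) :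
    Differentiable ℂ (besqKernelExt ν t y) := by
  unfold besqKernelExt
  have hB := differentiable_tsum_mul_pow _ (summable_besselCoeff hν)
  refine (Differentiable.mul (by fun_prop) ?_).const_mul _
  exact hB.comp (by fun_prop : Differentiable ℂ fun s : ℂ => 1 / (4 * (t : ℂ) ^ 2) * (y * s))

theorem besqPhiPlus_eq {N : ℕ} {ν t : ℝ} (hν : -1 < ν) (ht : 0 < t) (a : Fin N → ℝ) (n : ℕ)
    {y : ℝ} (hy : 0 ≤ y) :
    besqPhiPlus ν a n t y = 1 / (2 * π * Complex.I) *
      ∮ s in C(0, contourRadius a), besqKernelExt ν t y s * (1 / pointProd a (n + 1) s) := by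
  rw [besqPhiPlus, circleIntegral_congr_of_arg_ne_pi (contourRadius_pos a)]
  intro s hs
  rw [besqKernel_eq_ext hν ht hy hs]

/-- For distinct initial points, `h_N^{(ν,+)}` is the Karlin–McGregor determinant divided by the
Vandermonde product of these points. -/
theorem besqHPlus_mul_vandermondeProd {N : ℕ} {ν t : ℝ} (hν : -1 < ν) (ht : 0 < t)
    (y a : Fin N → ℝ) (hy : ∀ k, 0 ≤ y k) (ha : Function.Injective a) :
    besqHPlus ν t y a * (vandermondeProd a : ℂ) =
      Matrix.det (Matrix.of fun j k : Fin N => besqKernelExt ν t (y k) (a j)) := by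
  rw [← det_circleIntegral_inv_pointProd a ha (fun k => besqKernelExt ν t (y k))
    fun k => differentiable_besqKernelExt hν t _, besqHPlus]
  congr 3
  ext j k
  exact besqPhiPlus_eq hν ht a j (hy k)

/-- The leading coefficient of the `n`th Taylor coefficient of
`s ↦ besqKernelExt ν t y s / besqWeight ν t y`, as a polynomial in `y`. -/
noncomputable def besqCoeff (ν t : ℝ) (n : ℕ) : ℂ := besselCoeff ν n * (1 / (4 * t ^ 2)) ^ n

theorem besqHPlus_zero {N : ℕ} {ν t : ℝ} (hν : -1 < ν) (ht : 0 < t) (y : Fin N → ℝ)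
    (hy : ∀ k, 0 ≤ y k) :
    besqHPlus ν t y (fun _ => 0) = (∏ k, besqWeight ν t (y k)) *
      (∏ j : Fin N, besqCoeff ν t j) * (vandermondeProd y : ℂ) := by
  rw [besqHPlus, det_eval_of_natDegree_le y]
  intro j
  obtain ⟨p, h1, h2, h3⟩ := circleIntegral_mul_tsum_div_pow
    (fun s => Complex.exp (-s / (2 * t))) (by fun_prop) (by simp)
    (besselCoeff ν) (summable_besselCoeff hν) (1 / (4 * t ^ 2))
    (contourRadius_pos (fun _ : Fin N => (0 : ℝ))) j
  refine ⟨p, h1, h2, fun k => ?_⟩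
  rw [← h3, besqPhiPlus_eq hν ht _ _ (hy k)]
  simp_rw [pointProd_zero (Nat.succ_le_of_lt j.2), besqKernelExt, mul_assoc]
  rw [circleIntegral.integral_const_mul]
  ring

theorem besqHPlus_zero_eq_det {N : ℕ} {ν t : ℝ} (hν : -1 < ν) (ht : 0 < t) (y : Fin N → ℝ)
    (hy : ∀ k, 0 ≤ y k) :
    besqHPlus ν t y (fun _ => 0) =
      Matrix.det (Matrix.of fun i j : Fin N =>
        besqCoeff ν t i * ((y j : ℂ) ^ (i : ℕ) * besqWeight ν t (y j))) := by
  rw [besqHPlus_zero hν ht y hy, det_eval_of_natDegree_le y]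
  intro j
  refine ⟨Polynomial.C (besqCoeff ν t j) * Polynomial.X ^ (j : ℕ),
    Polynomial.natDegree_C_mul_X_pow_le _ _, by simp, fun k => ?_⟩
  simp
  ring

open Polynomial in
/-- The squared Bessel flow maps a polynomial of degree `i` times the weight at time `s` to such a
product at time `t + s`, with the matching leading coefficient. -/
theorem integral_besqKernelExt_mul_pow {ν t s : ℝ} (hν : -1 < ν) (ht : 0 < t) (hs : 0 < s)
    (i : ℕ) :
    (∀ y : ℝ, IntegrableOn (fun u : ℝ =>
      besqKernelExt ν t y u * (besqCoeff ν s i * ((u : ℂ) ^ i * besqWeight ν s u))) (Set.Ici 0)) ∧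
    ∃ p : ℂ[X], p.natDegree ≤ i ∧ p.coeff i = besqCoeff ν (t + s) i ∧
      ∀ y : ℝ, 0 ≤ y → ∫ u in Set.Ici (0 : ℝ),
          besqKernelExt ν t y u * (besqCoeff ν s i * ((u : ℂ) ^ i * besqWeight ν s u)) =
        besqWeight ν (t + s) y * p.eval (y : ℂ) := by
  have htc : (t : ℂ) ≠ 0 := by exact_mod_cast ht.ne'
  have hsc : (s : ℂ) ≠ 0 := by exact_mod_cast hs.ne'
  have htsc : (t + s : ℂ) ≠ 0 := by exact_mod_cast (add_pos ht hs).ne'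
  set ρ : ℝ := (t + s) / (2 * t * s) with hρdef
  have hρ : 0 < ρ := by positivity
  have hF : ∀ (y : ℝ), ∀ u ∈ Set.Ioi (0 : ℝ),
      (besqWeight ν t y * ((1 / (2 * s) ^ (ν + 1) : ℝ) : ℂ) * besqCoeff ν s i) *
        (((u ^ (ν + i) * Real.exp (-(ρ * u)) : ℝ) : ℂ) *
        ∑' m : ℕ, besselCoeff ν m * ((y / (4 * t ^ 2)) * u) ^ m) =
      besqKernelExt ν t y u * (besqCoeff ν s i * ((u : ℂ) ^ i * besqWeight ν s u)) := by
    intro y u hu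
    have hu' : 0 < u := hu
    have he : Complex.exp (-u / (2 * t)) * Complex.exp (-u / (2 * s)) =
        (Real.exp (-(ρ * u)) : ℝ) := by
      rw [← Complex.exp_add]
      push_cast
      congr 1
      rw [hρdef]
      push_cast
      field_simp
      ring
    have hm : 1 / (4 * (t : ℂ) ^ 2) * (y * u) = y / (4 * t ^ 2) * u := by ring
    rw [besqKernelExt, hm, besqWeight, besqWeight, Real.rpow_add_natCast hu'.ne',
      Complex.ofReal_mul, ← he]
    push_cast
    ring
  obtain ⟨q, hq1, hq2, hq3⟩ := exists_polynomial_bessel_moment hν i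
  refine ⟨fun y => ?_, C (besqCoeff ν s i * (1 / ρ) ^ i) * q.comp (C (1 / (4 * t ^ 2 * ρ) : ℂ) * X),
    ?_, ?_, fun y hy => ?_⟩
  · rw [integrableOn_Ici_iff_integrableOn_Ioi]
    exact IntegrableOn.congr_fun ((hq3 ρ hρ _).1.const_mul _) (hF y) measurableSet_Ioi
  · refine (natDegree_C_mul_le _ _).trans (natDegree_comp_le.trans ?_)
    calc q.natDegree * (C (1 / (4 * t ^ 2 * ρ : ℂ)) * X).natDegree ≤ i * 1 :=
          Nat.mul_le_mul hq1 ((natDegree_C_mul_le _ _).trans natDegree_X_le)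
      _ = i := mul_one i
  · rw [coeff_C_mul, comp_C_mul_X_coeff, hq2, besqCoeff, besqCoeff, one_mul, mul_assoc, mul_assoc,
      ← mul_pow, ← mul_pow]
    congr 2
    rw [hρdef]
    push_cast
    field_simp
    ring
  · rw [integral_Ici_eq_integral_Ioi, ← setIntegral_congr_fun measurableSet_Ioi (hF y),
      integral_const_mul, (hq3 ρ hρ _).2]
    have e1 : (1 / ρ) ^ (ν + i + 1) = (1 / ρ) ^ (ν + 1) * (1 / ρ) ^ i := by
      rw [← Real.rpow_natCast, ← Real.rpow_add (by positivity)]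
      ring_nf
    have e2 : (y : ℂ) / (4 * t ^ 2) / ρ = 1 / (4 * t ^ 2 * ρ) * y := by
      ring
    have e3 : Complex.exp (-y / (2 * t)) * Complex.exp (1 / (4 * t ^ 2 * ρ) * y) =
        Complex.exp (-y / (2 * ((t + s : ℝ) : ℂ))) := by
      rw [← Complex.exp_add]
      congr 1
      rw [hρdef]
      push_cast
      field_simp
      ring
    have e4 : y ^ ν / (2 * t) ^ (ν + 1) * (1 / (2 * s) ^ (ν + 1)) * (1 / ρ) ^ (ν + 1) =
        y ^ ν / (2 * (t + s)) ^ (ν + 1) := by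
      have h2 : (2 * t) * (2 * s) * ρ = 2 * (t + s) := by
        rw [hρdef]
        field_simp
      rw [← h2, Real.mul_rpow (by positivity) hρ.le,
        Real.mul_rpow (x := 2 * t) (y := 2 * s) (by positivity) (by positivity),
        Real.div_rpow zero_le_one hρ.le, Real.one_rpow, div_mul_div_comm, div_mul_div_comm,
        mul_one, mul_one]
    rw [e1, e2, besqWeight, besqWeight, ← e3, ← e4]
    simp only [eval_mul, eval_C, eval_comp, eval_X]
    push_cast
    ring

/-- The semigroup property for the squared Bessel kernels, with initial configuration `N δ₀`. -/
theorem setIntegral_besqHPlus {N : ℕ} {ν t s : ℝ} (hν : -1 < ν) (ht : 0 < t) (hs : 0 < s)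
    (y : Fin N → ℝ) (hy : ∀ k, 0 ≤ y k) :
    IntegrableOn (fun a => besqHPlus ν t y a *
        ((vandermondeProd a : ℂ) * besqHPlus ν s a (fun _ => 0))) (weylPos N) ∧
    ∫ a in weylPos N, besqHPlus ν t y a *
        ((vandermondeProd a : ℂ) * besqHPlus ν s a (fun _ => 0)) =
      besqHPlus ν (t + s) y (fun _ => 0) := by
  have hcongr : ∀ a ∈ weylPos N,
      Matrix.det (Matrix.of fun j k : Fin N => besqKernelExt ν t (y k) (a j)) *
        Matrix.det (Matrix.of fun i j : Fin N =>
          besqCoeff ν s i * ((a j : ℂ) ^ (i : ℕ) * besqWeight ν s (a j))) =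
      besqHPlus ν t y a * ((vandermondeProd a : ℂ) * besqHPlus ν s a (fun _ => 0)) := by
    intro a ha
    rw [← besqHPlus_mul_vandermondeProd hν ht y a hy ha.1.injective,
      besqHPlus_zero_eq_det hν hs a ha.2, mul_assoc]
  obtain ⟨h1, h2⟩ := integral_weylPos_det_mul_det
    (fun (i : Fin N) (u : ℝ) => besqCoeff ν s i * ((u : ℂ) ^ (i : ℕ) * besqWeight ν s u))
    (fun k u => besqKernelExt ν t (y k) u)
    (fun i j => (integral_besqKernelExt_mul_pow hν ht hs i).1 (y j))
  refine ⟨h1.congr_fun hcongr (measurableSet_weylPos N), ?_⟩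
  rw [← setIntegral_congr_fun (measurableSet_weylPos N) hcongr, h2,
    besqHPlus_zero hν (add_pos ht hs) y hy, det_eval_of_natDegree_le y]
  intro i
  obtain ⟨p, hp1, hp2, hp3⟩ := (integral_besqKernelExt_mul_pow hν ht hs i).2
  exact ⟨p, hp1, hp2, fun k => hp3 (y k) (hy k)⟩

/-- The chGUE density is, up to a Vandermonde factor, `h_N^{(ν,+)}` for the initial configuration
`N δ₀`, at time `σ²`. -/
theorem chguePdf_eq {N : ℕ} {ν σ : ℝ} (hν : -1 < ν) (hσ : 0 < σ) (a : Fin N → ℝ)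
    (ha : ∀ k, 0 ≤ a k) :
    (chguePdf ν σ a : ℂ) = (vandermondeProd a : ℂ) * besqHPlus ν (σ ^ 2) a (fun _ => 0) := by
  have hw : ∀ u : ℝ, besqWeight ν (σ ^ 2) u =
      ((u ^ ν * Real.exp (-u / (2 * σ ^ 2)) * (1 / (2 * σ ^ 2) ^ (ν + 1)) : ℝ) : ℂ) := by
    intro u
    rw [besqWeight]
    push_cast
    ring
  have hc : ∀ j : Fin N, besqCoeff ν (σ ^ 2) j =
      ((1 / (Real.Gamma ((j : ℝ) + 1) * Real.Gamma ((j : ℝ) + 1 + ν)) *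
        (1 / ((2 * σ ^ 2) ^ 2) ^ (j : ℕ)) : ℝ) : ℂ) := by
    intro j
    rw [besqCoeff, besselCoeff]
    push_cast
    rw [one_div_pow]
    ring
  have hσ2 : σ ^ (-(2 * N * (N + ν))) = 1 / (σ ^ 2) ^ (N * (N + ν)) := by
    rw [← Real.rpow_natCast σ 2, ← Real.rpow_mul hσ.le, Real.rpow_neg hσ.le, one_div]
    congr 2
    push_cast
    ring
  have hpow : (2 : ℝ) ^ ((N : ℝ) * (N + ν)) * (σ ^ 2) ^ (N * (N + ν)) =
      ((2 * σ ^ 2) ^ (ν + 1)) ^ N * ∏ j : Fin N, ((2 * σ ^ 2) ^ 2) ^ (j : ℕ) := by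
    rw [← Real.mul_rpow (by positivity) (by positivity)]
    have h2 : (0 : ℝ) < 2 * σ ^ 2 := by positivity
    have h1 : ((2 * σ ^ 2) ^ (ν + 1)) ^ N = (2 * σ ^ 2) ^ (ν * N) * (2 * σ ^ 2) ^ N := by
      rw [Real.rpow_add h2, Real.rpow_one, mul_pow, ← Real.rpow_natCast (_ ^ ν),
        ← Real.rpow_mul h2.le]
    rw [h1, mul_assoc, mul_comm (_ ^ N), prod_sq_pow_mul_self, ← Real.rpow_natCast _ (N ^ 2),
      ← Real.rpow_add h2]
    congr 1
    push_cast
    ring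
  rw [besqHPlus_zero hν (by positivity) a ha]
  simp_rw [hw, hc]
  rw [← Complex.ofReal_prod, ← Complex.ofReal_prod]
  norm_cast
  push_cast
  rw [chguePdf, hσ2, div_div, ← mul_assoc (_ ^ _) (_ ^ _), mul_comm (_ ^ _) (2 ^ _), hpow,
    Finset.prod_mul_distrib (f := fun j => a j ^ ν * Real.exp (-a j / (2 * σ ^ 2))),
    Finset.prod_mul_distrib
      (f := fun j : Fin N => 1 / (Real.Gamma ((j : ℝ) + 1) * Real.Gamma ((j : ℝ) + 1 + ν)))]
  simp only [one_div, Finset.prod_inv_distrib, Finset.prod_const, Finset.card_univ,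
    Fintype.card_fin]
  ring

/-! ### Multitime densities of Karlin–McGregor type -/

/-- The features which the two families of multitime densities have in common. The densities
`dens a` from the initial points `a`, on the chamber `W`, are products of a harmonic function `H` at
the last time, of transition kernels `K`, and of an entrance factor at the first time. The latter is
`K / V` for points `a` in `W`, and `h` for the initial configuration `N δ₀`. The functions `H` and
`V` agree almost everywhere (for the squared Bessel process they may differ by a phase at points
with a zero coordinate). The density `pdf` is that of the process started from `N δ₀` at time `s`,
and `semigroup` propagates it. -/
structure IsKarlinMcGregorFamily {N : ℕ} (W : Set (Fin N → ℝ))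
    (dens : (Fin N → ℝ) → ∀ {M : ℕ}, (Fin (M + 1) → ℝ) → (Fin (M + 1) → Fin N → ℝ) → ℂ)
    (pdf : (Fin N → ℝ) → ℝ) (s : ℝ) (H V : (Fin N → ℝ) → ℂ)
    (K : ℝ → (Fin N → ℝ) → (Fin N → ℝ) → ℂ) (h : ℝ → (Fin N → ℝ) → ℂ) : Prop where
  pos : 0 < s
  measurableSet : MeasurableSet W
  measurable_pdf : Measurable pdf
  pdf_nonneg : ∀ a ∈ W, 0 ≤ pdf a
  measurable_H : Measurable H
  measurable_V : Measurable V
  measurable_K : ∀ t, 0 < t → Measurable fun z : (Fin N → ℝ) × (Fin N → ℝ) => K t z.1 z.2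
  measurable_h : ∀ t, 0 < t → Measurable (h t)
  V_ne_zero : ∀ a ∈ W, V a ≠ 0
  H_ae_eq : ∀ᵐ a ∂volume.restrict W, H a = V a
  pdf_eq : ∀ a ∈ W, (pdf a : ℂ) = V a * h s a
  dens_eq : ∀ {M : ℕ} (t : Fin (M + 1) → ℝ), 0 < t 0 → StrictMono t →
    ∀ x : Fin (M + 1) → Fin N → ℝ, (∀ m, x m ∈ W) → ∀ a ∈ W, dens a t x =
      H (x (Fin.last M)) * (∏ m : Fin M, K (t m.succ - t m.castSucc) (x m.succ) (x m.castSucc)) *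
        (K (t 0) (x 0) a / V a)
  dens_zero : ∀ {M : ℕ} (t : Fin (M + 1) → ℝ), 0 < t 0 → StrictMono t →
    ∀ x : Fin (M + 1) → Fin N → ℝ, (∀ m, x m ∈ W) → dens (fun _ => 0) t x =
      H (x (Fin.last M)) * (∏ m : Fin M, K (t m.succ - t m.castSucc) (x m.succ) (x m.castSucc)) *
        h (t 0) (x 0)
  semigroup : ∀ t, 0 < t → ∀ y ∈ W, IntegrableOn (fun a => K t y a / V a * pdf a) W ∧
    ∫ a in W, K t y a / V a * pdf a = h (t + s) y

namespace IsKarlinMcGregorFamily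

variable {N : ℕ} {W : Set (Fin N → ℝ)}
  {dens : (Fin N → ℝ) → ∀ {M : ℕ}, (Fin (M + 1) → ℝ) → (Fin (M + 1) → Fin N → ℝ) → ℂ}
  {pdf : (Fin N → ℝ) → ℝ} {s : ℝ} {H V : (Fin N → ℝ) → ℂ}
  {K : ℝ → (Fin N → ℝ) → (Fin N → ℝ) → ℂ} {h : ℝ → (Fin N → ℝ) → ℂ}

/-- Averaging over the initial law shifts all times by `s`: only the entrance factor depends on the
initial points, so this is the semigroup property. -/
theorem integral_dens_mul_pdf (hd : IsKarlinMcGregorFamily W dens pdf s H V K h) {M : ℕ}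
    (t : Fin (M + 1) → ℝ) (ht : 0 < t 0) (hmono : StrictMono t) (x : Fin (M + 1) → Fin N → ℝ)
    (hx : ∀ m, x m ∈ W) :
    IntegrableOn (fun a => dens a t x * (pdf a : ℂ)) W ∧
      ∫ a in W, dens a t x * (pdf a : ℂ) = dens (fun _ => 0) (fun m => t m + s) x := by
  have hs := hd.pos
  obtain ⟨h1, h2⟩ := hd.semigroup (t 0) ht (x 0) (hx 0)
  set c := H (x (Fin.last M)) *
    (∏ m : Fin M, K (t m.succ - t m.castSucc) (x m.succ) (x m.castSucc)) with hc
  have hcongr : ∀ a ∈ W, c * (K (t 0) (x 0) a / V a * pdf a) = dens a t x * (pdf a : ℂ) := by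
    intro a ha
    rw [hd.dens_eq t ht hmono x hx a ha]
    ring
  refine ⟨IntegrableOn.congr_fun (h1.const_mul c) hcongr hd.measurableSet, ?_⟩
  rw [← setIntegral_congr_fun hd.measurableSet hcongr, integral_const_mul, h2,
    hd.dens_zero (fun m => t m + s) (by positivity) (fun i j hij => by simpa using hmono hij) x hx]
  simp only [add_sub_add_right_eq_sub, hc]

theorem dens_zero_one_ae (hd : IsKarlinMcGregorFamily W dens pdf s H V K h) :
    ∀ᵐ a ∂volume.restrict W,
      dens (fun _ => 0) (fun _ : Fin 1 => s) (fun _ : Fin 1 => a) = (pdf a : ℂ) := by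
  filter_upwards [hd.H_ae_eq, ae_restrict_mem hd.measurableSet] with a ha haW
  have hmono : StrictMono fun _ : Fin (0 + 1) => s := fun i j hij => absurd hij (by omega)
  rw [hd.dens_zero (M := 0) (fun _ => s) hd.pos hmono _ fun _ => haW, hd.pdf_eq a haW]
  simp [ha]

/-- Markov property at time `s` of the process started from `N δ₀`, on the level of densities: the
factor `V` from the initial density cancels the one in the entrance factor. -/
theorem dens_mul_pdf_eq_dens_cons (hd : IsKarlinMcGregorFamily W dens pdf s H V K h) {M : ℕ}
    (t : Fin (M + 1) → ℝ) (ht : 0 < t 0) (hmono : StrictMono t) (x : Fin (M + 1) → Fin N → ℝ)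
    (hx : ∀ m, x m ∈ W) (a : Fin N → ℝ) (ha : a ∈ W) :
    dens a t x * (pdf a : ℂ) = dens (fun _ => 0)
      (Fin.cons s fun m => t m + s : Fin (M + 2) → ℝ) (Fin.cons a x : Fin (M + 2) → Fin N → ℝ) := by
  have hmono' : StrictMono (Fin.cons s fun m => t m + s : Fin (M + 2) → ℝ) := by
    rw [Fin.strictMono_iff_lt_succ]
    intro i
    refine Fin.cases ?_ (fun j => ?_) i
    · simpa using ht
    · rw [← Fin.succ_castSucc]
      simp only [Fin.cons_succ]
      have := hmono (Fin.castSucc_lt_succ (i := j))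
      linarith
  have hx' : ∀ m, (Fin.cons a x : Fin (M + 2) → Fin N → ℝ) m ∈ W := by
    intro m
    refine Fin.cases ?_ (fun j => ?_) m
    · simpa using ha
    · simpa using hx j
  rw [hd.dens_zero _ (by simpa using hd.pos) hmono' _ hx', hd.dens_eq t ht hmono x hx a ha,
    hd.pdf_eq a ha, Fin.prod_univ_succ, ← Fin.succ_last]
  simp only [Fin.cons_succ, Fin.castSucc_zero, Fin.cons_zero, ← Fin.succ_castSucc,
    add_sub_add_right_eq_sub, add_sub_cancel_right]
  have := hd.V_ne_zero a ha
  field_simp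

theorem aemeasurable_dens (hd : IsKarlinMcGregorFamily W dens pdf s H V K h) {M : ℕ}
    (t : Fin (M + 1) → ℝ) (ht : 0 < t 0) (hmono : StrictMono t) :
    AEMeasurable (fun z : (Fin N → ℝ) × (Fin (M + 1) → Fin N → ℝ) => dens z.1 t z.2)
      ((volume.restrict W).prod (volume.restrict {x | ∀ m, x m ∈ W})) := by
  refine AEMeasurable.congr (f := fun z : (Fin N → ℝ) × (Fin (M + 1) → Fin N → ℝ) =>
    H (z.2 (Fin.last M)) *
      (∏ m : Fin M, K (t m.succ - t m.castSucc) (z.2 m.succ) (z.2 m.castSucc)) *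
        (K (t 0) (z.2 0) z.1 / V z.1)) (Measurable.aemeasurable ?_) ?_
  · have hcoord : ∀ m, Measurable fun z : (Fin N → ℝ) × (Fin (M + 1) → Fin N → ℝ) => z.2 m :=
      fun m => (measurable_pi_apply m).comp measurable_snd
    refine ((hd.measurable_H.comp (hcoord _)).mul (Finset.measurable_prod _ fun m _ => ?_)).mul
      (((hd.measurable_K (t 0) ht).comp ((hcoord 0).prodMk measurable_fst)).div
        (hd.measurable_V.comp measurable_fst))
    exact (hd.measurable_K _ (sub_pos.2 (hmono Fin.castSucc_lt_succ))).comp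
      ((hcoord _).prodMk (hcoord _))
  · have hW' : MeasurableSet {x : Fin (M + 1) → Fin N → ℝ | ∀ m, x m ∈ W} := by
      rw [Set.ofPred_forall]
      exact MeasurableSet.iInter fun m => measurable_pi_apply m hd.measurableSet
    rw [Measure.prod_restrict]
    filter_upwards [ae_restrict_mem (hd.measurableSet.prod hW')] with z hz
    exact (hd.dens_eq t ht hmono z.2 hz.2 z.1 hz.1).symm

theorem aemeasurable_dens_zero (hd : IsKarlinMcGregorFamily W dens pdf s H V K h) {M : ℕ}
    (t : Fin (M + 1) → ℝ) (ht : 0 < t 0) (hmono : StrictMono t) :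
    AEMeasurable (fun x : Fin (M + 1) → Fin N → ℝ => dens (fun _ => 0) t x)
      (volume.restrict {x | ∀ m, x m ∈ W}) := by
  refine AEMeasurable.congr (f := fun x : Fin (M + 1) → Fin N → ℝ =>
    H (x (Fin.last M)) * (∏ m : Fin M, K (t m.succ - t m.castSucc) (x m.succ) (x m.castSucc)) *
        h (t 0) (x 0)) (Measurable.aemeasurable ?_) ?_
  · have hcoord : ∀ m, Measurable fun x : Fin (M + 1) → Fin N → ℝ => x m := measurable_pi_apply
    refine ((hd.measurable_H.comp (hcoord _)).mul (Finset.measurable_prod _ fun m _ => ?_)).mul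
      ((hd.measurable_h (t 0) ht).comp (hcoord 0))
    exact (hd.measurable_K _ (sub_pos.2 (hmono Fin.castSucc_lt_succ))).comp
      ((hcoord _).prodMk (hcoord _))
  · have hW' : MeasurableSet {x : Fin (M + 1) → Fin N → ℝ | ∀ m, x m ∈ W} := by
      rw [Set.ofPred_forall]
      exact MeasurableSet.iInter fun m => measurable_pi_apply m hd.measurableSet
    filter_upwards [ae_restrict_mem hW'] with x hx
    exact (hd.dens_zero t ht hmono x hx).symm

end IsKarlinMcGregorFamily

theorem measurable_config (N : ℕ) : Measurable (config (N := N)) := by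
  refine Measure.measurable_of_measurable_coe _ fun S hS => ?_
  simp only [config, Measure.finsetSum_apply, Measure.dirac_apply' _ hS]
  exact Finset.measurable_sum _ fun j _ =>
    (measurable_const.indicator hS).comp (measurable_pi_apply j)

theorem jointLaw_map_snd {N M : ℕ} (W : Set (Fin N → ℝ)) (init : Measure (Fin N → ℝ)) [SFinite init]
    (D : (Fin N → ℝ) → (Fin (M + 1) → Fin N → ℝ) → ℂ)
    (hD : AEMeasurable (fun z : (Fin N → ℝ) × (Fin (M + 1) → Fin N → ℝ) => D z.1 z.2)
      (init.prod (volume.restrict {x | ∀ m, x m ∈ W}))) :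
    (jointLaw W init D).map Prod.snd = (volume.restrict {x | ∀ m, x m ∈ W}).withDensity
      fun x => ∫⁻ a, ENNReal.ofReal (D a x).re ∂init := by
  ext S hS
  have hpre : (Prod.snd ⁻¹' S : Set ((Fin N → ℝ) × (Fin (M + 1) → Fin N → ℝ))) =
      Set.univ ×ˢ S := by
    ext z
    simp
  have hD' : AEMeasurable (fun z : (Fin N → ℝ) × (Fin (M + 1) → Fin N → ℝ) =>
      ENNReal.ofReal (D z.1 z.2).re) (init.prod (volume.restrict {x | ∀ m, x m ∈ W})) :=
    (Complex.measurable_re.comp_aemeasurable hD).ennreal_ofReal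
  rw [Measure.map_apply measurable_snd hS, withDensity_apply _ hS, jointLaw,
    withDensity_apply _ (measurable_snd hS), hpre, ← Measure.prod_restrict, Measure.restrict_univ,
    lintegral_prod_symm]
  refine hD'.mono_measure ?_
  rw [← Measure.restrict_univ (μ := init), Measure.prod_restrict, Measure.restrict_univ]
  exact Measure.restrict_le_self

theorem ofReal_integral_le_lintegral_ofReal {α : Type*} [MeasurableSpace α] {μ : Measure α}
    {f : α → ℝ} (hf : Integrable f μ) :
    ENNReal.ofReal (∫ a, f a ∂μ) ≤ ∫⁻ a, ENNReal.ofReal (f a) ∂μ := by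
  refine ENNReal.ofReal_le_of_le_toReal ?_
  rw [integral_eq_lintegral_pos_part_sub_lintegral_neg_part hf]
  exact sub_le_self _ ENNReal.toReal_nonneg

namespace HasMultitimeDensities

variable {N : ℕ} {W : Set (Fin N → ℝ)}
  {dens : (Fin N → ℝ) → ∀ {M : ℕ}, (Fin (M + 1) → ℝ) → (Fin (M + 1) → Fin N → ℝ) → ℂ}
  {init : Measure (Fin N → ℝ)} {Ω : Type*} [MeasurableSpace Ω] {P : Measure Ω}
  {X : ℝ≥0 → Ω → Measure ℝ}

theorem map_pi_eq [SFinite init] (hX : HasMultitimeDensities W dens init P X) {M : ℕ}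
    (t : Fin (M + 1) → ℝ≥0) (ht : 0 < t 0) (hmono : StrictMono t)
    (hD : AEMeasurable (fun z : (Fin N → ℝ) × (Fin (M + 1) → Fin N → ℝ) =>
      dens z.1 (fun m => (t m : ℝ)) z.2) (init.prod (volume.restrict {x | ∀ m, x m ∈ W}))) :
    P.map (fun ω m => X (t m) ω) = ((volume.restrict {x | ∀ m, x m ∈ W}).withDensity
      fun x => ∫⁻ a, ENNReal.ofReal (dens a (fun m => (t m : ℝ)) x).re ∂init).map
        fun x m => config (x m) := by
  have hXm : Measurable fun ω => (X 0 ω, fun m => X (t m) ω) :=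
    (hX.measurable 0).prodMk (measurable_pi_lambda _ fun m => hX.measurable (t m))
  have hc : Measurable fun x : Fin (M + 1) → Fin N → ℝ => fun m => config (x m) :=
    measurable_pi_lambda _ fun m => (measurable_config N).comp (measurable_pi_apply m)
  have hcc : Measurable fun z : (Fin N → ℝ) × (Fin (M + 1) → Fin N → ℝ) =>
      (config z.1, fun m => config (z.2 m)) :=
    ((measurable_config N).comp measurable_fst).prodMk (hc.comp measurable_snd)
  have h1 := congrArg (Measure.map Prod.snd) (hX.law M t ht hmono)
  rw [Measure.map_map measurable_snd hXm, Measure.map_map measurable_snd hcc] at h1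
  rw [← jointLaw_map_snd W init _ hD, Measure.map_map hc measurable_snd]
  exact h1

end HasMultitimeDensities

/-! ### Finite-dimensional distributions -/

theorem map_withDensity_comp_equiv {α β : Type*} [MeasurableSpace α] [MeasurableSpace β]
    {μ : Measure α} {ν : Measure β} (e : α ≃ᵐ β) (he : MeasurePreserving e μ ν) (G : β → ℝ≥0∞) :
    (μ.withDensity fun x => G (e x)).map e = ν.withDensity G := by
  ext A hA
  rw [Measure.map_apply e.measurable hA, withDensity_apply _ (e.measurable hA),
    withDensity_apply _ hA, he.setLIntegral_comp_preimage_emb e.measurableEmbedding G A]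

namespace IsKarlinMcGregorFamily

variable {N : ℕ} {W : Set (Fin N → ℝ)}
  {dens : (Fin N → ℝ) → ∀ {M : ℕ}, (Fin (M + 1) → ℝ) → (Fin (M + 1) → Fin N → ℝ) → ℂ}
  {pdf : (Fin N → ℝ) → ℝ} {s : ℝ≥0} {H V : (Fin N → ℝ) → ℂ}
  {K : ℝ → (Fin N → ℝ) → (Fin N → ℝ) → ℂ} {h : ℝ → (Fin N → ℝ) → ℂ}
  {Ω : Type*} [MeasurableSpace Ω] {P : Measure Ω} {X : ℝ≥0 → Ω → Measure ℝ}
  {Ω' : Type*} [MeasurableSpace Ω'] {P' : Measure Ω'} {Y : ℝ≥0 → Ω' → Measure ℝ}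

theorem map_pi_eq_of_dirac (hd : IsKarlinMcGregorFamily W dens pdf s H V K h)
    (hY : HasMultitimeDensities W dens (Measure.dirac (fun _ : Fin N => (0 : ℝ))) P' Y) {M : ℕ}
    (t : Fin (M + 1) → ℝ≥0) (ht : 0 < t 0) (hmono : StrictMono t) :
    P'.map (fun ω m => Y (t m) ω) = ((volume.restrict {x | ∀ m, x m ∈ W}).withDensity
      fun x => ENNReal.ofReal (dens (fun _ => 0) (fun m => (t m : ℝ)) x).re).map
        fun x m => config (x m) := by
  rw [hY.map_pi_eq t ht hmono]
  · simp_rw [lintegral_dirac]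
  · rw [Measure.dirac_prod, (measurableEmbedding_prodMk_left _).aemeasurable_map_iff]
    exact hd.aemeasurable_dens_zero _ (by exact_mod_cast ht) fun i j hij => by
      exact_mod_cast hmono hij

/-- The law of a process is built from the positive parts of its densities, and the positive part of
an average is at most the average of the positive parts. -/
theorem ofReal_dens_zero_le (hd : IsKarlinMcGregorFamily W dens pdf s H V K h) {M : ℕ}
    (t : Fin (M + 1) → ℝ≥0) (ht : 0 < t 0) (hmono : StrictMono t) (x : Fin (M + 1) → Fin N → ℝ)
    (hx : ∀ m, x m ∈ W) :
    ENNReal.ofReal (dens (fun _ => 0) (fun m => ((t m + s : ℝ≥0) : ℝ)) x).re ≤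
      ∫⁻ a, ENNReal.ofReal (dens a (fun m => (t m : ℝ)) x).re
        ∂((volume.restrict W).withDensity fun a => ENNReal.ofReal (pdf a)) := by
  obtain ⟨h1, h2⟩ := hd.integral_dens_mul_pdf (fun m => (t m : ℝ)) (by exact_mod_cast ht)
    (fun i j hij => by exact_mod_cast hmono hij) x hx
  rw [lintegral_withDensity_eq_lintegral_mul_non_measurable _ hd.measurable_pdf.ennreal_ofReal
    (Filter.Eventually.of_forall fun _ => ENNReal.ofReal_lt_top)]
  have hre : ∀ a ∈ W, ((fun a => ENNReal.ofReal (pdf a)) *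
      fun a => ENNReal.ofReal (dens a (fun m => (t m : ℝ)) x).re) a =
      ENNReal.ofReal (dens a (fun m => (t m : ℝ)) x * (pdf a : ℂ)).re := by
    intro a ha
    rw [Complex.re_mul_ofReal, mul_comm (Complex.re _), ENNReal.ofReal_mul (hd.pdf_nonneg a ha)]
    rfl
  rw [setLIntegral_congr_fun hd.measurableSet hre]
  have h3 : (dens (fun _ => 0) (fun m => ((t m + s : ℝ≥0) : ℝ)) x).re =
      ∫ a in W, (dens a (fun m => (t m : ℝ)) x * (pdf a : ℂ)).re := by
    have := integral_re (𝕜 := ℂ) h1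
    simp only [RCLike.re_eq_complex_re] at this
    rw [this, h2]
    simp only [NNReal.coe_add]
  rw [h3]
  exact ofReal_integral_le_lintegral_ofReal h1.re

/-- At positive times, `ofReal_dens_zero_le` compares the densities of the two finite-dimensional
laws. Both are probability measures, so the densities agree almost everywhere; no positivity of the
determinants is needed. -/
theorem map_pi_eq_of_pos [IsProbabilityMeasure P] [IsProbabilityMeasure P']
    (hd : IsKarlinMcGregorFamily W dens pdf s H V K h)
    (hX : HasMultitimeDensities W dens
      ((volume.restrict W).withDensity fun a => ENNReal.ofReal (pdf a)) P X)
    (hY : HasMultitimeDensities W dens (Measure.dirac (fun _ : Fin N => (0 : ℝ))) P' Y) {M : ℕ}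
    (t : Fin (M + 1) → ℝ≥0) (ht : 0 < t 0) (hmono : StrictMono t) :
    P.map (fun ω m => X (t m) ω) = P'.map (fun ω m => Y (t m + s) ω) := by
  have hlawY := hd.map_pi_eq_of_dirac hY (fun m => t m + s) (by positivity)
    (fun i j hij => by simpa using hmono hij)
  have hmeasX : AEMeasurable (fun z : (Fin N → ℝ) × (Fin (M + 1) → Fin N → ℝ) =>
      dens z.1 (fun m => (t m : ℝ)) z.2)
      (((volume.restrict W).withDensity fun a => ENNReal.ofReal (pdf a)).prod
        (volume.restrict {x | ∀ m, x m ∈ W})) :=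
    (hd.aemeasurable_dens _ (by exact_mod_cast ht) fun i j hij => by
      exact_mod_cast hmono hij).mono_ac
        ((withDensity_absolutelyContinuous _ _).prod Measure.AbsolutelyContinuous.rfl)
  have hlawX := hX.map_pi_eq t ht hmono hmeasX
  have hW' : MeasurableSet {x : Fin (M + 1) → Fin N → ℝ | ∀ m, x m ∈ W} := by
    rw [Set.ofPred_forall]
    exact MeasurableSet.iInter fun m => measurable_pi_apply m hd.measurableSet
  have hc : Measurable fun x : Fin (M + 1) → Fin N → ℝ => fun m => config (x m) :=
    measurable_pi_lambda _ fun m => (measurable_config N).comp (measurable_pi_apply m)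
  have hXm : Measurable fun ω => fun m => X (t m) ω :=
    measurable_pi_lambda _ fun m => hX.measurable (t m)
  have hYm : Measurable fun ω => fun m => Y (t m + s) ω :=
    measurable_pi_lambda _ fun m => hY.measurable (t m + s)
  have massX := congrArg (fun μ => μ Set.univ) hlawX
  have massY := congrArg (fun μ => μ Set.univ) hlawY
  simp only [Measure.map_apply hXm MeasurableSet.univ, Measure.map_apply hYm MeasurableSet.univ,
    Measure.map_apply hc MeasurableSet.univ, Set.preimage_univ, measure_univ,
    withDensity_apply _ MeasurableSet.univ, Measure.restrict_univ] at massX massY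
  rw [hlawX, hlawY]
  congr 1
  refine withDensity_congr_ae ?_
  refine (ae_eq_of_ae_le_of_lintegral_le ?_ ?_ ?_ ?_).symm
  · filter_upwards [ae_restrict_mem hW'] with x hx
    exact hd.ofReal_dens_zero_le t ht hmono x hx
  · rw [← massY]
    exact ENNReal.one_ne_top
  · exact ((Complex.measurable_re.comp_aemeasurable hmeasX).ennreal_ofReal).lintegral_prod_left'
  · rw [← massX, ← massY]

/-- The case of the single time `0`: the initial law is the law at time `s` of the process started
from `N δ₀`. -/
theorem map_zero_eq (hd : IsKarlinMcGregorFamily W dens pdf s H V K h)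
    (hX : HasMultitimeDensities W dens
      ((volume.restrict W).withDensity fun a => ENNReal.ofReal (pdf a)) P X)
    (hY : HasMultitimeDensities W dens (Measure.dirac (fun _ : Fin N => (0 : ℝ))) P' Y) :
    P.map (fun ω (_ : Fin 1) => X 0 ω) = P'.map (fun ω (_ : Fin 1) => Y s ω) := by
  have hs : 0 < s := by exact_mod_cast hd.pos
  have hc : Measurable fun x : Fin 1 → Fin N → ℝ => fun m => config (x m) :=
    measurable_pi_lambda _ fun m => (measurable_config N).comp (measurable_pi_apply m)
  have hconst : Measurable fun (c : Measure ℝ) (_ : Fin 1) => c :=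
    measurable_pi_lambda _ fun _ => measurable_id
  have hlawY := hd.map_pi_eq_of_dirac hY (M := 0) (fun _ => s) hs
    (fun i j hij => absurd hij (by omega))
  have hlawX : P.map (fun ω (_ : Fin 1) => X 0 ω) =
      ((volume.restrict W).withDensity fun a => ENNReal.ofReal (pdf a)).map
        fun a (_ : Fin 1) => config a := by
    have := congrArg (Measure.map fun (c : Measure ℝ) (_ : Fin 1) => c) hX.law_zero
    rw [Measure.map_map hconst (hX.measurable 0), Measure.map_map hconst (measurable_config N)]
      at this
    exact this
  rw [hlawX]
  refine Eq.trans ?_ hlawY.symm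
  set e := MeasurableEquiv.funUnique (Fin 1) (Fin N → ℝ) with he
  have hpre : {x : Fin (0 + 1) → Fin N → ℝ | ∀ m, x m ∈ W} = e ⁻¹' W := by
    ext x
    simp only [Set.mem_ofPred_eq, Set.mem_preimage]
    exact ⟨fun hx => hx 0, fun hx m => by rwa [show m = 0 by omega]⟩
  have hpres : MeasurePreserving e (volume.restrict {x : Fin (0 + 1) → Fin N → ℝ | ∀ m, x m ∈ W})
      (volume.restrict W) := by
    rw [hpre]
    exact (volume_preserving_funUnique (Fin 1) (Fin N → ℝ)).restrict_preimage hd.measurableSet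
  have hmap := map_withDensity_comp_equiv e hpres fun a => ENNReal.ofReal
    (dens (fun _ => 0) (fun _ : Fin (0 + 1) => (s : ℝ)) fun _ => a).re
  have hfun : ∀ x : Fin (0 + 1) → Fin N → ℝ, (fun _ : Fin (0 + 1) => e x) = x := fun x => by
    ext m
    rw [show m = 0 by omega]
    rfl
  simp only [hfun] at hmap
  have hX' : (volume.restrict W).withDensity (fun a => ENNReal.ofReal (pdf a)) =
      (volume.restrict W).withDensity fun a => ENNReal.ofReal
        (dens (fun _ => 0) (fun _ : Fin (0 + 1) => (s : ℝ)) fun _ => a).re := by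
    refine withDensity_congr_ae ?_
    filter_upwards [hd.dens_zero_one_ae] with a ha
    rw [ha, Complex.ofReal_re]
  have hcc : Measurable fun (a : Fin N → ℝ) (_ : Fin (0 + 1)) => config a :=
    hconst.comp (measurable_config N)
  rw [hX', ← hmap, Measure.map_map hcc e.measurable]
  congr 1
  ext1 x
  funext m
  exact congrArg config (congrFun (hfun x) m)

/-- Time `0` followed by positive times: the joint law involves the initial points, whose density
times the multitime density is a multitime density of the process started from `N δ₀`, with `s` as
an additional first time. -/
theorem map_cons_eq (hd : IsKarlinMcGregorFamily W dens pdf s H V K h)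
    (hX : HasMultitimeDensities W dens
      ((volume.restrict W).withDensity fun a => ENNReal.ofReal (pdf a)) P X)
    (hY : HasMultitimeDensities W dens (Measure.dirac (fun _ : Fin N => (0 : ℝ))) P' Y) {M : ℕ}
    (t : Fin (M + 1) → ℝ≥0) (ht : 0 < t 0) (hmono : StrictMono t) :
    P.map (fun ω (m : Fin (M + 2)) => X ((Fin.cons 0 t : Fin (M + 2) → ℝ≥0) m) ω) =
      P'.map (fun ω (m : Fin (M + 2)) => Y ((Fin.cons 0 t : Fin (M + 2) → ℝ≥0) m + s) ω) := by
  have hs : 0 < s := by exact_mod_cast hd.pos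
  have ht' : 0 < ((fun m => (t m : ℝ)) : Fin (M + 1) → ℝ) 0 := by exact_mod_cast ht
  have hmono' : StrictMono ((fun m => (t m : ℝ)) : Fin (M + 1) → ℝ) :=
    fun i j hij => by exact_mod_cast hmono hij
  have hmono0 : StrictMono fun m => (Fin.cons 0 t : Fin (M + 2) → ℝ≥0) m + s := by
    refine StrictMono.add_const ?_ s
    rw [Fin.strictMono_iff_lt_succ]
    intro i
    refine Fin.cases ?_ (fun j => ?_) i
    · simpa using ht
    · rw [← Fin.succ_castSucc]
      simp only [Fin.cons_succ]
      exact hmono Fin.castSucc_lt_succ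
  have hlawY := hd.map_pi_eq_of_dirac hY (fun m => (Fin.cons 0 t : Fin (M + 2) → ℝ≥0) m + s)
    (by simpa using hs) hmono0
  have hW' : MeasurableSet {x : Fin (M + 1) → Fin N → ℝ | ∀ m, x m ∈ W} := by
    rw [Set.ofPred_forall]
    exact MeasurableSet.iInter fun m => measurable_pi_apply m hd.measurableSet
  have hcons : ∀ {α : Type} [MeasurableSpace α], Measurable fun p : α × (Fin (M + 1) → α) =>
      (Fin.cons p.1 p.2 : Fin (M + 2) → α) := by
    intro α _
    refine measurable_pi_lambda _ fun m => ?_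
    refine Fin.cases ?_ (fun j => ?_) m
    · simpa using measurable_fst
    · simp only [Fin.cons_succ]
      exact (measurable_pi_apply j).comp measurable_snd
  have hXm : Measurable fun ω => (X 0 ω, fun m => X (t m) ω) :=
    (hX.measurable 0).prodMk (measurable_pi_lambda _ fun m => hX.measurable (t m))
  have hcc : Measurable fun z : (Fin N → ℝ) × (Fin (M + 1) → Fin N → ℝ) =>
      (config z.1, fun m => config (z.2 m)) :=
    ((measurable_config N).comp measurable_fst).prodMk (measurable_pi_lambda _ fun m =>
      (measurable_config N).comp ((measurable_pi_apply m).comp measurable_snd))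
  have hlawX := congrArg (Measure.map fun p : Measure ℝ × (Fin (M + 1) → Measure ℝ) =>
      (Fin.cons p.1 p.2 : Fin (M + 2) → Measure ℝ)) (hX.law M t ht hmono)
  rw [Measure.map_map hcons hXm, Measure.map_map hcons hcc] at hlawX
  have hXfun : (fun ω (m : Fin (M + 2)) => X ((Fin.cons 0 t : Fin (M + 2) → ℝ≥0) m) ω) =
      (fun p : Measure ℝ × (Fin (M + 1) → Measure ℝ) =>
        (Fin.cons p.1 p.2 : Fin (M + 2) → Measure ℝ)) ∘ fun ω => (X 0 ω, fun m => X (t m) ω) := by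
    funext ω m
    refine Fin.cases ?_ (fun j => ?_) m <;> simp
  rw [hXfun, hlawX]
  refine Eq.trans ?_ hlawY.symm
  set e := MeasurableEquiv.piFinSuccAbove (fun _ : Fin (M + 2) => Fin N → ℝ) 0 with he
  have he1 : ∀ x, (e x).1 = x 0 := fun x => rfl
  have he2 : ∀ x j, (e x).2 j = x j.succ := fun x j => rfl
  have hecons : ∀ x, (Fin.cons (e x).1 (e x).2 : Fin (M + 2) → Fin N → ℝ) = x := by
    intro x
    funext m
    refine Fin.cases ?_ (fun j => ?_) m
    · simp [he1]
    · simp [he2]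
  have hpre : {x : Fin (M + 1 + 1) → Fin N → ℝ | ∀ m, x m ∈ W} =
      e ⁻¹' (W ×ˢ {x : Fin (M + 1) → Fin N → ℝ | ∀ m, x m ∈ W}) := by
    ext x
    simp only [Set.mem_ofPred_eq, Set.mem_preimage, Set.mem_prod, he1, he2]
    exact Fin.forall_fin_succ
  have hpres : MeasurePreserving e
      (volume.restrict {x : Fin (M + 1 + 1) → Fin N → ℝ | ∀ m, x m ∈ W})
      ((volume.restrict W).prod (volume.restrict {x | ∀ m, x m ∈ W})) := by
    rw [hpre, Measure.prod_restrict]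
    exact (volume_preserving_piFinSuccAbove (fun _ : Fin (M + 2) => Fin N → ℝ)
      0).restrict_preimage (hd.measurableSet.prod hW')
  set τ : Fin (M + 2) → ℝ := fun m => (((Fin.cons 0 t : Fin (M + 2) → ℝ≥0) m + s : ℝ≥0) : ℝ)
    with hτ
  have hτcons : τ = Fin.cons (s : ℝ) fun m => (t m : ℝ) + s := by
    funext m
    refine Fin.cases ?_ (fun j => ?_) m <;> simp [hτ]
  have hmap := map_withDensity_comp_equiv e hpres fun z => ENNReal.ofReal
    (dens (fun _ => 0) τ (Fin.cons z.1 z.2 : Fin (M + 2) → Fin N → ℝ)).re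
  simp only [hecons] at hmap
  have hjoint : jointLaw W ((volume.restrict W).withDensity fun a => ENNReal.ofReal (pdf a))
      (fun a x => dens a (fun m => (t m : ℝ)) x) =
      ((volume.restrict W).prod (volume.restrict {x | ∀ m, x m ∈ W})).withDensity fun z =>
        ENNReal.ofReal (dens (fun _ => 0) τ (Fin.cons z.1 z.2 : Fin (M + 2) → Fin N → ℝ)).re := by
    have hp : AEMeasurable (fun z : (Fin N → ℝ) × (Fin (M + 1) → Fin N → ℝ) =>
        ENNReal.ofReal (pdf z.1))
        ((volume.restrict W).prod (volume.restrict {x | ∀ m, x m ∈ W})) :=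
      (hd.measurable_pdf.comp measurable_fst).ennreal_ofReal.aemeasurable
    have hmeas : AEMeasurable (fun z : (Fin N → ℝ) × (Fin (M + 1) → Fin N → ℝ) =>
        ENNReal.ofReal (dens z.1 (fun m => (t m : ℝ)) z.2).re)
        ((volume.restrict W).prod (volume.restrict {x | ∀ m, x m ∈ W})) :=
      (Complex.measurable_re.comp_aemeasurable
        (hd.aemeasurable_dens _ ht' hmono')).ennreal_ofReal
    rw [jointLaw, prod_withDensity_left hd.measurable_pdf.ennreal_ofReal,
      ← withDensity_mul₀ hp hmeas]
    refine withDensity_congr_ae ?_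
    rw [Measure.prod_restrict]
    filter_upwards [ae_restrict_mem (hd.measurableSet.prod hW')] with z hz
    have hEq := hd.dens_mul_pdf_eq_dens_cons _ ht' hmono' z.2 hz.2 z.1 hz.1
    rw [hτcons, ← hEq, Complex.re_mul_ofReal, mul_comm (Complex.re _),
      ENNReal.ofReal_mul (hd.pdf_nonneg _ hz.1)]
    rfl
  rw [hjoint, ← hmap, Measure.map_map (hcons.comp hcc) e.measurable]
  congr 1
  funext x m
  refine Fin.cases ?_ (fun j => ?_) m
  · simp [he1]
  · simp [he2]

theorem map_eq [IsProbabilityMeasure P] [IsProbabilityMeasure P']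
    (hd : IsKarlinMcGregorFamily W dens pdf s H V K h)
    (hX : HasMultitimeDensities W dens
      ((volume.restrict W).withDensity fun a => ENNReal.ofReal (pdf a)) P X)
    (hY : HasMultitimeDensities W dens (Measure.dirac (fun _ : Fin N => (0 : ℝ))) P' Y) {n : ℕ}
    (t : Fin n → ℝ≥0) (hmono : StrictMono t) :
    P.map (fun ω m => X (t m) ω) = P'.map (fun ω m => Y (t m + s) ω) := by
  rcases n with _ | n
  · -- No times at all: probability measures on a one-point space.
    have hXm : Measurable fun ω => fun m => X (t m) ω :=
      measurable_pi_lambda _ fun m => hX.measurable (t m)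
    have hYm : Measurable fun ω => fun m => Y (t m + s) ω :=
      measurable_pi_lambda _ fun m => hY.measurable (t m + s)
    have := Measure.isProbabilityMeasure_map (μ := P) hXm.aemeasurable
    have := Measure.isProbabilityMeasure_map (μ := P') hYm.aemeasurable
    ext S _
    rcases Set.eq_empty_or_nonempty S with rfl | ⟨c, hc⟩
    · simp
    · have : S = Set.univ := by
        ext d
        simp [Subsingleton.elim d c, hc]
      rw [this, measure_univ, measure_univ]
  · rcases eq_zero_or_pos (t 0) with h0 | h0
    · rcases n with _ | n
      · have ht : ∀ m, t m = 0 := fun m => by rw [show m = 0 by omega, h0]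
        simp only [ht, zero_add]
        exact hd.map_zero_eq hX hY
      · have ht : t = Fin.cons 0 fun m : Fin (n + 1) => t m.succ := by
          funext m
          refine Fin.cases ?_ (fun j => ?_) m
          · simpa using h0
          · simp
        rw [ht]
        refine hd.map_cons_eq hX hY (fun m : Fin (n + 1) => t m.succ) ?_ ?_
        · exact h0 ▸ hmono (Fin.succ_pos 0)
        · exact fun i j hij => hmono (Fin.succ_lt_succ_iff.2 hij)
    · exact hd.map_pi_eq_of_pos hX hY t h0 hmono

end IsKarlinMcGregorFamily

/-! ### The two families of processes -/

theorem measurable_vandermondeProd (N : ℕ) :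
    Measurable fun y : Fin N → ℝ => (vandermondeProd y : ℂ) := by
  unfold vandermondeProd
  fun_prop

theorem vandermondeProd_ne_zero {N : ℕ} {a : Fin N → ℝ} (ha : Function.Injective a) :
    vandermondeProd a ≠ 0 :=
  Finset.prod_ne_zero_iff.2 fun _ _ => Finset.prod_ne_zero_iff.2 fun _ hk =>
    sub_ne_zero.2 (ha.ne (Finset.mem_Ioi.1 hk).ne')

theorem measurable_matrix_det {α : Type*} [MeasurableSpace α] {N : ℕ} {F : α → Fin N → Fin N → ℂ}
    (hF : ∀ j k, Measurable fun z => F z j k) :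
    Measurable fun z => Matrix.det (Matrix.of fun j k => F z j k) := by
  simp only [Matrix.det_apply, Matrix.of_apply]
  exact Finset.measurable_sum _ fun τ _ =>
    (Finset.measurable_prod _ fun j _ => hF _ _).const_smul _

theorem last_pos_of_strictMono {M : ℕ} {t : Fin (M + 1) → ℝ} (ht : 0 < t 0) (hmono : StrictMono t) :
    0 < t (Fin.last M) :=
  ht.trans_le (hmono.monotone (Fin.zero_le _))

theorem guePdf_nonneg {N : ℕ} {σ : ℝ} (hσ : 0 < σ) (a : Fin N → ℝ) : 0 ≤ guePdf σ a := by
  have : ∀ j : Fin N, 0 < Real.Gamma ((j : ℝ) + 1) := fun j => Real.Gamma_pos_of_pos (by positivity)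
  have := Finset.prod_pos fun j (_ : j ∈ Finset.univ) => this j
  unfold guePdf
  positivity

theorem chguePdf_nonneg {N : ℕ} {ν σ : ℝ} (hν : -1 < ν) (hσ : 0 < σ) (a : Fin N → ℝ)
    (ha : ∀ k, 0 ≤ a k) : 0 ≤ chguePdf ν σ a := by
  have : ∀ j : Fin N, 0 < Real.Gamma ((j : ℝ) + 1) * Real.Gamma ((j : ℝ) + 1 + ν) := fun j =>
    mul_pos (Real.Gamma_pos_of_pos (by positivity))
      (Real.Gamma_pos_of_pos (by linarith [(j : ℕ).cast_nonneg (α := ℝ)]))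
  have h1 := Finset.prod_pos fun j (_ : j ∈ Finset.univ) => this j
  have h2 : 0 ≤ ∏ j, (a j ^ ν * Real.exp (-(a j) / (2 * σ ^ 2))) :=
    Finset.prod_nonneg fun j _ => mul_nonneg (Real.rpow_nonneg (ha j) _) (Real.exp_nonneg _)
  unfold chguePdf
  positivity

theorem bmHPlus_eq_bmKM_div {N : ℕ} (t : ℝ) (y a : Fin N → ℝ) (ha : Function.Injective a) :
    bmHPlus t y a = bmKM t y a / (vandermondeProd a : ℂ) := by
  rw [eq_div_iff (by exact_mod_cast vandermondeProd_ne_zero ha),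
    bmHPlus_mul_vandermondeProd t y a ha, bmKM, ← Matrix.det_transpose]
  rfl

theorem isKarlinMcGregorFamily_bmDensity (N : ℕ) {σ : ℝ} (hσ : 0 < σ) :
    IsKarlinMcGregorFamily (weylA N) (fun a {_} t x => bmDensity a t x) (guePdf σ) (σ ^ 2)
      (fun y => (vandermondeProd y : ℂ)) (fun y => (vandermondeProd y : ℂ)) bmKM
      (fun t y => bmHPlus t y fun _ => 0) where
  pos := by positivity
  measurableSet := measurableSet_weylA N
  measurable_pdf := by
    unfold guePdf vandermondeProd
    fun_prop
  pdf_nonneg a _ := guePdf_nonneg hσ a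
  measurable_H := measurable_vandermondeProd N
  measurable_V := measurable_vandermondeProd N
  measurable_K t _ := by
    refine measurable_matrix_det fun j k => ?_
    unfold bmKernel
    fun_prop
  measurable_h t ht := by
    simp only [bmHPlus_zero ht]
    refine (Measurable.mul ?_ measurable_const).mul (measurable_vandermondeProd N)
    unfold bmWeight
    fun_prop
  V_ne_zero a ha := by exact_mod_cast vandermondeProd_ne_zero (StrictMono.injective ha)
  H_ae_eq := Filter.Eventually.of_forall fun _ => rfl
  pdf_eq a _ := guePdf_eq hσ a
  dens_eq t ht hmono x _ a ha := by
    rw [bmDensity, bmHMinus_eq (last_pos_of_strictMono ht hmono),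
      bmHPlus_eq_bmKM_div _ _ _ (StrictMono.injective ha)]
  dens_zero t ht hmono x _ := by
    rw [bmDensity, bmHMinus_eq (last_pos_of_strictMono ht hmono)]
  semigroup t ht y _ := by
    obtain ⟨h1, h2⟩ := setIntegral_bmHPlus ht (show 0 < σ ^ 2 by positivity) y
    have hcongr : ∀ a ∈ weylA N,
        bmHPlus t y a * ((vandermondeProd a : ℂ) * bmHPlus (σ ^ 2) a (fun _ => 0)) =
          bmKM t y a / (vandermondeProd a : ℂ) * guePdf σ a := fun a ha => by
      rw [guePdf_eq hσ, bmHPlus_eq_bmKM_div _ _ _ (StrictMono.injective ha)]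
    exact ⟨h1.congr_fun hcongr (measurableSet_weylA N),
      (setIntegral_congr_fun (measurableSet_weylA N) hcongr).symm.trans h2⟩

/-- The Karlin–McGregor determinant of the squared Bessel process, with the kernel replaced by its
entire version; it agrees with `besqKM` at tuples of nonnegative numbers. -/
noncomputable def besqKMExt {N : ℕ} (ν t : ℝ) (y a : Fin N → ℝ) : ℂ :=
  Matrix.det (Matrix.of fun j k : Fin N => besqKernelExt ν t (y j) (a k))

/-- Nonnegative numbers have argument `0`, off the branch cut. -/
theorem besqKM_eq_besqKMExt {N : ℕ} {ν t : ℝ} (hν : -1 < ν) (ht : 0 < t) {y a : Fin N → ℝ}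
    (hy : ∀ k, 0 ≤ y k) (ha : ∀ k, 0 ≤ a k) :
    besqKM ν t y a = besqKMExt ν t y a := by
  rw [besqKM, besqKMExt]
  congr 2
  ext j k
  refine besqKernel_eq_ext hν ht (hy j) ?_
  rw [Complex.arg_ofReal_of_nonneg (ha k)]
  exact Real.pi_pos.ne

theorem besqHPlus_eq_besqKMExt_div {N : ℕ} {ν t : ℝ} (hν : -1 < ν) (ht : 0 < t) {y a : Fin N → ℝ}
    (hy : ∀ k, 0 ≤ y k) (ha : Function.Injective a) :
    besqHPlus ν t y a = besqKMExt ν t y a / (vandermondeProd a : ℂ) := by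
  rw [eq_div_iff (by exact_mod_cast vandermondeProd_ne_zero ha),
    besqHPlus_mul_vandermondeProd hν ht y a hy ha, besqKMExt, ← Matrix.det_transpose]
  rfl

theorem measurable_besqWeight (ν t : ℝ) : Measurable (besqWeight ν t) := by
  unfold besqWeight
  fun_prop

theorem measurable_besqKernelExt {ν : ℝ} (hν : -1 < ν) (t : ℝ) :
    Measurable fun z : ℝ × ℝ => besqKernelExt ν t z.1 z.2 := by
  unfold besqKernelExt
  have hB := (differentiable_tsum_mul_pow _ (summable_besselCoeff hν)).continuous
  refine ((measurable_besqWeight ν t).comp measurable_fst).mul (Measurable.mul (by fun_prop) ?_)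
  exact (hB.comp (by fun_prop : Continuous fun z : ℝ × ℝ =>
    1 / (4 * (t : ℂ) ^ 2) * ((z.1 : ℂ) * z.2))).measurable

theorem measurable_besqKMExt {N : ℕ} {ν : ℝ} (hν : -1 < ν) (t : ℝ) :
    Measurable fun z : (Fin N → ℝ) × (Fin N → ℝ) => besqKMExt ν t z.1 z.2 := by
  have hF : ∀ j k : Fin N, Measurable fun z : (Fin N → ℝ) × (Fin N → ℝ) =>
      besqKernelExt ν t (z.1 j) (z.2 k) := by
    intro j k
    have hjk : Measurable fun z : (Fin N → ℝ) × (Fin N → ℝ) => (z.1 j, z.2 k) := by fun_prop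
    have hcomp := (measurable_besqKernelExt hν t).comp hjk
    exact hcomp
  exact measurable_matrix_det hF

theorem ae_besqPhase_eq_one (ν : ℝ) (N : ℕ) :
    ∀ᵐ y : Fin N → ℝ, ∏ k, besqPhase ν (y k) = 1 := by
  have h : ∀ k : Fin N, ∀ᵐ y : Fin N → ℝ, y k ≠ 0 := fun k =>
    (Measure.ae_eval_ne (fun _ : Fin N => (volume : Measure ℝ)) k 0)
  filter_upwards [MeasureTheory.ae_all_iff.2 h] with y hy
  exact Finset.prod_eq_one fun k _ => if_neg (hy k)

theorem isKarlinMcGregorFamily_besqDensity (N : ℕ) {ν σ : ℝ} (hν : -1 < ν) (hσ : 0 < σ) :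
    IsKarlinMcGregorFamily (weylPos N) (fun a {_} t x => besqDensity ν a t x) (chguePdf ν σ)
      (σ ^ 2) (fun y => (∏ k, besqPhase ν (y k)) * (vandermondeProd y : ℂ))
      (fun y => (vandermondeProd y : ℂ))
      (besqKMExt ν)
      (fun t y => (∏ k, besqWeight ν t (y k)) * (∏ j : Fin N, besqCoeff ν t j) *
        (vandermondeProd y : ℂ)) where
  pos := by positivity
  measurableSet := measurableSet_weylPos N
  measurable_pdf := by
    unfold chguePdf vandermondeProd
    fun_prop
  pdf_nonneg a ha := chguePdf_nonneg hν hσ a ha.2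
  measurable_H := by
    refine (Finset.measurable_prod _ fun k _ => ?_).mul (measurable_vandermondeProd N)
    unfold besqPhase
    exact Measurable.ite (measurableSet_eq_fun (measurable_pi_apply k) measurable_const)
      measurable_const measurable_const
  measurable_V := measurable_vandermondeProd N
  measurable_K t _ := measurable_besqKMExt hν t
  measurable_h t _ := ((Finset.measurable_prod _ fun k _ =>
    (measurable_besqWeight ν t).comp (measurable_pi_apply k)).mul measurable_const).mul
      (measurable_vandermondeProd N)
  V_ne_zero a ha := by exact_mod_cast vandermondeProd_ne_zero ha.1.injective
  H_ae_eq := ae_restrict_of_ae <| by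
    filter_upwards [ae_besqPhase_eq_one ν N] with y hy
    rw [hy, one_mul]
  pdf_eq a ha := by rw [chguePdf_eq hν hσ a ha.2, besqHPlus_zero hν (by positivity) a ha.2]
  dens_eq t ht hmono x hx a ha := by
    rw [besqDensity, besqHMinus_eq hν (last_pos_of_strictMono ht hmono) _ _ (hx _).2,
      besqHPlus_eq_besqKMExt_div hν ht (hx 0).2 ha.1.injective]
    simp only [besqKM_eq_besqKMExt hν (sub_pos.2 (hmono Fin.castSucc_lt_succ)) (hx _).2 (hx _).2]
  dens_zero t ht hmono x hx := by
    rw [besqDensity, besqHMinus_eq hν (last_pos_of_strictMono ht hmono) _ _ (hx _).2,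
      besqHPlus_zero hν ht _ (hx 0).2]
    simp only [besqKM_eq_besqKMExt hν (sub_pos.2 (hmono Fin.castSucc_lt_succ)) (hx _).2 (hx _).2]
  semigroup t ht y hy := by
    obtain ⟨h1, h2⟩ := setIntegral_besqHPlus hν ht (show 0 < σ ^ 2 by positivity) y hy.2
    have hcongr : ∀ a ∈ weylPos N,
        besqHPlus ν t y a * ((vandermondeProd a : ℂ) * besqHPlus ν (σ ^ 2) a (fun _ => 0)) =
          besqKMExt ν t y a / (vandermondeProd a : ℂ) * chguePdf ν σ a := fun a ha => by
      rw [chguePdf_eq hν hσ a ha.2, besqHPlus_eq_besqKMExt_div hν ht hy.2 ha.1.injective]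
    refine ⟨h1.congr_fun hcongr (measurableSet_weylPos N), ?_⟩
    rw [← setIntegral_congr_fun (measurableSet_weylPos N) hcongr, h2,
      besqHPlus_zero hν (by positivity) y hy.2]

end NoncollidingDiffusion

theorem theorem1 (N : ℕ) (hN : 0 < N) (σ : ℝ) (hσ : 0 < σ) :
    -- multitime densities of the noncolliding Brownian motion
    (∀ (M : ℕ) (t : Fin (M + 1) → ℝ), 0 < t 0 → StrictMono t →
      ∀ x : Fin (M + 1) → Fin N → ℝ, (∀ m, x m ∈ weylA N) →
        IntegrableOn (fun a => bmDensity a t x * (guePdf σ a : ℂ)) (weylA N) ∧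
        gueExpect σ (fun a => bmDensity a t x)
          = bmDensity (fun _ : Fin N => (0 : ℝ)) (fun m => t m + σ ^ 2) x) ∧
    -- multitime densities of the noncolliding squared Bessel process
    (∀ ν : ℝ, -1 < ν → ∀ (M : ℕ) (t : Fin (M + 1) → ℝ), 0 < t 0 → StrictMono t →
      ∀ x : Fin (M + 1) → Fin N → ℝ, (∀ m, x m ∈ weylPos N) →
        IntegrableOn (fun a => besqDensity ν a t x * (chguePdf ν σ a : ℂ)) (weylPos N) ∧
        chgueExpect ν σ (fun a => besqDensity ν a t x)
          = besqDensity ν (fun _ : Fin N => (0 : ℝ)) (fun m => t m + σ ^ 2) x) ∧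
    -- equality in finite-dimensional distributions, noncolliding Brownian motion
    (∀ (Ω Ω' : Type*) [MeasurableSpace Ω] [MeasurableSpace Ω']
      (P : Measure Ω) [IsProbabilityMeasure P] (P' : Measure Ω') [IsProbabilityMeasure P']
      (X : ℝ≥0 → Ω → Measure ℝ) (Y : ℝ≥0 → Ω' → Measure ℝ),
      IsNoncollidingBM (gueLaw N σ) P X →
      IsNoncollidingBM (Measure.dirac (fun _ : Fin N => (0 : ℝ))) P' Y →
      ∀ (n : ℕ) (t : Fin n → ℝ≥0), StrictMono t →
        P.map (fun ω m => X (t m) ω)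
          = P'.map (fun ω m => Y (t m + Real.toNNReal (σ ^ 2)) ω)) ∧
    -- equality in finite-dimensional distributions, noncolliding squared Bessel process
    (∀ ν : ℝ, -1 < ν → ∀ (Ω Ω' : Type*) [MeasurableSpace Ω] [MeasurableSpace Ω']
      (P : Measure Ω) [IsProbabilityMeasure P] (P' : Measure Ω') [IsProbabilityMeasure P']
      (X : ℝ≥0 → Ω → Measure ℝ) (Y : ℝ≥0 → Ω' → Measure ℝ),
      IsNoncollidingBESQ ν (chgueLaw N ν σ) P X →
      IsNoncollidingBESQ ν (Measure.dirac (fun _ : Fin N => (0 : ℝ))) P' Y →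
      ∀ (n : ℕ) (t : Fin n → ℝ≥0), StrictMono t →
        P.map (fun ω m => X (t m) ω)
          = P'.map (fun ω m => Y (t m + Real.toNNReal (σ ^ 2)) ω)) := by
  have hpos : 0 < σ ^ 2 := by positivity
  have hcoe : ((Real.toNNReal (σ ^ 2) : ℝ≥0) : ℝ) = σ ^ 2 := Real.coe_toNNReal _ hpos.le
  have hbm := isKarlinMcGregorFamily_bmDensity N hσ
  refine ⟨fun M t ht hmono x hx => hbm.integral_dens_mul_pdf t ht hmono x hx,
    fun ν hν M t ht hmono x hx =>
      (isKarlinMcGregorFamily_besqDensity N hν hσ).integral_dens_mul_pdf t ht hmono x hx, ?_, ?_⟩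
  · intro Ω Ω' _ _ P _ P' _ X Y hX hY n t hmono
    rw [← hcoe] at hbm
    exact hbm.map_eq hX hY t hmono
  · intro ν hν Ω Ω' _ _ P _ P' _ X Y hX hY n t hmono
    have hbesq := isKarlinMcGregorFamily_besqDensity N hν hσ
    rw [← hcoe] at hbesq
    exact hbesq.map_eq hX hY t hmono
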